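/- **Setting.** Let $\mathbf G$ be an indexing category, i.e. a finite nonempty poset category in which any two objects have a minimal common ancestor; equivalently a finite nonempty meet-semilattice, with one arrow $i\to j$ exactly when $i\le j$, and with initial object $0$. Let $|\mathbf G|$ be its number of objects. A $\mathbf G$-diagram $\mathcal X=\{X_i;\chi_{ij}\}$ is a functor from $\mathbf G$ to the category of finite probability spaces (sets with a finitely supported probability measure) and reductions (measure-preserving maps modulo a.e. equality). Tensor products $\otimes$ (independent products) and powers $\mathcal X^n$ are taken objectwise, $\mathrm{Ent}$ is Shannon entropy, and $$\mathbf k(\mathcal X,\mathcal Y)=\inf_{\mathcal X\leftarrow\mathcal Z\to\mathcal Y}\ \sum_{i\in\mathbf G}\Big(|\mathrm{Ent}\,Z_i-\mathrm{Ent}\,X_i|+|\mathrm{Ent}\,Z_i-\mathrm{Ent}\,Y_i|\Big),\qquad \boldsymbol\kappa(\mathcal X,\mathcal Y)=\lim_{n\to\infty}\tfrac1n\,\mathbf k(\mathcal X^n,\mathcal Y^n),$$ the infimum being over all fans of $\mathbf G$-diagrams. Fix a positive admissible function $\varphi:[1,\infty)\to(0,\infty)$: it is non-decreasing and there is $D$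 with $8t\int_t^\infty \varphi(s)s^{-2}\,ds\le D\varphi(t)<\infty$ for all $t\ge1$. A sequence $\bar{\mathcal X}=(\mathcal X(n))_{n\ge0}$ of $\mathbf G$-diagrams is quasi-linear if, for some $C$, $\boldsymbol\kappa(\mathcal X(n+m),\mathcal X(n)\otimes\mathcal X(m))\le C\varphi(n+m)$ for all $n,m\ge 0$ with $n+m\ge1$. The space $\mathrm{Prob}[\mathbf G]$ of tropical $\mathbf G$-diagrams consists of the classes $[\bar{\mathcal X}]$ of quasi-linear sequences modulo distance $0$, where the distance is $\boldsymbol\kappa(\bar{\mathcal X},\bar{\mathcal Y})=\lim_n\frac1n\boldsymbol\kappa(\mathcal X(n),\mathcal Y(n))$; it carries the addition induced by the termwise tensor product and the action of $\mathbb R_{\ge0}$ induced by $(\lambda\bar{\mathcal X})(n)=\mathcal X(\lfloor\lambda n\rfloor)$. For a $\mathbf G$-diagram $\mathcal X$, an object $\iota$, and an atom $u$ of $U=X_\iota$ (a point of positive weight), $\mathcal X|u$ is the diagram with the same sets and maps in which the distribution of $X_0$ is conditioned on the preimage of $u$, and the other distributions are its push-forwards. Put $$[\mathcal X|U]=\sum_{u\in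 U}p_U(u)\,\big[(\mathcal X|u)^n\big]_{n\ge0}\in \mathrm{Prob}[\mathbf G].$$ **Theorem (tropical conditioning).** Let $\iota\in\mathbf G$. For every quasi-linear sequence $\bar{\mathcal X}=(\mathcal X(n))_n$ with $U(n):=X_\iota(n)$, the limit $$[\mathcal X|U]:=\lim_{n\to\infty}\tfrac1n\,[\mathcal X(n)|U(n)]$$ exists in $\mathrm{Prob}[\mathbf G]$ and depends only on the class $[\bar{\mathcal X}]$, not on the representative. The resulting conditioning map $[\,\cdot\,|\,\cdot_\iota]:\mathrm{Prob}[\mathbf G]\to\mathrm{Prob}[\mathbf G]$ is linear (additive and $\mathbb R_{\ge0}$-homogeneous) and Lipschitz, with constant $2|\mathbf G|+1$. -/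

import Mathlib

open Filter Topology
open scoped NNReal

set_option linter.unusedSectionVars false

namespace TropProb

/-- Finitely supported probability distributions on a set `S`. -/
abbrev Distribution (S : Type) : Type := Convexity.StdSimplex ℝ S

section Distributions

variable {S T C : Type}

/-- The (Shannon) entropy `- ∑ p(x) log p(x)`. -/
noncomputable def entropy (p : Distribution S) : ℝ :=
  p.weights.sum fun _ w => Real.negMulLog w

/-- The product distribution `p ⊗ q`. -/
noncomputable def tensorDist (p : Distribution S) (q : Distribution T) : Distribution (S × T) where
  weights := Finsupp.onFinset (p.weights.support ×ˢ q.weights.support)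
    (fun x => p.weights x.1 * q.weights x.2) (fun x hx => by
      simpa [Finset.mem_product] using hx)
  nonneg := fun x => mul_nonneg (p.nonneg x.1) (q.nonneg x.2)
  total := by
    have hp : ∑ x ∈ p.weights.support, p.weights x = 1 := p.total
    have hq : ∑ x ∈ q.weights.support, q.weights x = 1 := q.total
    rw [Finsupp.onFinset_sum _ (fun _ => rfl), Finset.sum_product]
    simp only [← Finset.mul_sum, hq, mul_one, hp]

/-- The expectation of a function (a tool for the proofs below). -/
noncomputable def expect (p : Distribution S) (f : S → ℝ) : ℝ :=
  p.weights.sum fun x w => w * f x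

lemma expect_eq (p : Distribution S) (f : S → ℝ) :
    expect p f = ∑ x ∈ p.weights.support, p.weights x * f x := rfl

lemma expect_congr (p : Distribution S) {f g : S → ℝ}
    (h : ∀ x ∈ p.weights.support, f x = g x) : expect p f = expect p g :=
  Finset.sum_congr rfl fun x hx => congrArg (p.weights x * ·) (h x hx)

lemma expect_mono (p : Distribution S) {f g : S → ℝ}
    (h : ∀ x ∈ p.weights.support, f x ≤ g x) : expect p f ≤ expect p g :=
  Finset.sum_le_sum fun x hx => mul_le_mul_of_nonneg_left (h x hx) (p.nonneg x)

lemma expect_map (p : Distribution S) (g : S → T) (f : T → ℝ) :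
    expect (p.map g) f = expect p (fun x => f (g x)) := by
  unfold expect
  rw [Convexity.StdSimplex.weights_map, Finsupp.sum_mapDomain_index]
  · intro; simp
  · intros; ring

lemma expect_add (p : Distribution S) (f g : S → ℝ) :
    expect p (fun x => f x + g x) = expect p f + expect p g := by
  simp [expect_eq, mul_add, Finset.sum_add_distrib]

lemma expect_neg (p : Distribution S) (f : S → ℝ) :
    expect p (fun x => - f x) = - expect p f := by
  simp [expect_eq]

lemma expect_const (p : Distribution S) (c : ℝ) : expect p (fun _ => c) = c := by
  have hp : ∑ x ∈ p.weights.support, p.weights x = 1 := p.total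
  simp [expect_eq, ← Finset.sum_mul, hp]

open Classical in
lemma expect_indicator (p : Distribution S) (a : S) :
    expect p (fun x => if x = a then 1 else 0) = p.weights a := by
  simp only [expect_eq, mul_ite, mul_one, mul_zero, Finset.sum_ite_eq']
  split_ifs with h
  · rfl
  · simpa using (Finsupp.notMem_support_iff.1 h).symm

lemma dist_ext {p q : Distribution S} (h : ∀ f, expect p f = expect q f) : p = q := by
  classical
  apply Convexity.StdSimplex.ext
  ext a
  rw [← expect_indicator, ← expect_indicator, h]

open Classical in
lemma map_weights_apply (p : Distribution S) (g : S → T) (t : T) :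
    (p.map g).weights t = expect p (fun x => if g x = t then 1 else 0) := by
  rw [← expect_indicator, expect_map]

lemma pos_of_mem {p : Distribution S} {x : S} (hx : x ∈ p.weights.support) : 0 < p.weights x :=
  lt_of_le_of_ne (p.nonneg x) (Ne.symm (Finsupp.mem_support_iff.1 hx))

lemma le_map_weights (p : Distribution S) (g : S → T) (x : S) :
    p.weights x ≤ (p.map g).weights (g x) := by
  classical
  rw [map_weights_apply, ← expect_indicator]
  apply expect_mono
  intro y _
  split_ifs with h1 h2 <;> simp_all

lemma mem_support_map {p : Distribution S} {x : S} (g : S → T) (hx : x ∈ p.weights.support) :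
    g x ∈ (p.map g).weights.support :=
  Finsupp.mem_support_iff.2 ((pos_of_mem hx).trans_le (le_map_weights p g x)).ne'

lemma exists_of_mem_support_map {p : Distribution S} {g : S → T} {t : T}
    (ht : t ∈ (p.map g).weights.support) : ∃ x ∈ p.weights.support, g x = t := by
  classical
  by_contra! h
  apply Finsupp.mem_support_iff.1 ht
  rw [map_weights_apply]
  refine (expect_congr p fun x hx => ?_).trans (expect_const p 0)
  simp [h x hx]

lemma map_congr (p : Distribution S) {f g : S → T}
    (h : ∀ x ∈ p.weights.support, f x = g x) : p.map f = p.map g := by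
  apply dist_ext
  intro F
  rw [expect_map, expect_map]
  exact expect_congr p fun x hx => by rw [h x hx]

lemma expect_tensor (p : Distribution S) (q : Distribution T) (F : S × T → ℝ) :
    expect (tensorDist p q) F = expect p (fun a => expect q (fun b => F (a, b))) := by
  unfold expect tensorDist
  rw [Finsupp.onFinset_sum _ (fun _ => by simp), Finset.sum_product]
  simp only [Finsupp.sum, Finset.mul_sum, mul_assoc]

lemma mem_support_tensor {p : Distribution S} {q : Distribution T} {x : S × T} :
    x ∈ (tensorDist p q).weights.support ↔ x.1 ∈ p.weights.support ∧ x.2 ∈ q.weights.support := by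
  simp [tensorDist, Finsupp.mem_support_iff]

lemma map_tensor {S' T' : Type} (p : Distribution S) (q : Distribution T)
    (f : S → S') (g : T → T') :
    (tensorDist p q).map (Prod.map f g) = tensorDist (p.map f) (q.map g) := by
  apply dist_ext
  intro F
  rw [expect_map, expect_tensor, expect_tensor, expect_map]
  simp only [expect_map, Prod.map]

lemma entropy_eq (p : Distribution S) :
    entropy p = expect p (fun x => - Real.log (p.weights x)) := by
  simp [entropy, expect_eq, Finsupp.sum, Real.negMulLog]

lemma entropy_tensor (p : Distribution S) (q : Distribution T) :
    entropy (tensorDist p q) = entropy p + entropy q := by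
  rw [entropy_eq, entropy_eq, entropy_eq, expect_tensor]
  have : ∀ a ∈ p.weights.support,
      expect q (fun b => - Real.log ((tensorDist p q).weights (a, b)))
        = - Real.log (p.weights a) + expect q (fun b => - Real.log (q.weights b)) := by
    intro a ha
    rw [← expect_const q (- Real.log (p.weights a)), ← expect_add]
    apply expect_congr
    intro b hb
    have : (tensorDist p q).weights (a, b) = p.weights a * q.weights b := rfl
    rw [this, Real.log_mul (pos_of_mem ha).ne' (pos_of_mem hb).ne']
    ring
  rw [expect_congr p this, expect_add, expect_const]

lemma entropy_map_le (p : Distribution S) (g : S → T) : entropy (p.map g) ≤ entropy p := by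
  rw [entropy_eq, entropy_eq, expect_map]
  apply expect_mono
  intro x hx
  have := Real.log_le_log (pos_of_mem hx) (le_map_weights p g x)
  linarith

open Classical in
/-- The relative product of two distributions over a common image. -/
noncomputable def glue (p : Distribution S) (q : Distribution T) (f : S → C) (g : T → C)
    (h : p.map f = q.map g) : Distribution (S × T) where
  weights := Finsupp.onFinset (p.weights.support ×ˢ q.weights.support)
    (fun x => p.weights x.1 * (q.weights x.2 *
      (if g x.2 = f x.1 then ((p.map f).weights (f x.1))⁻¹ else 0))) (fun x hx => by
        rw [Finset.mem_product, Finsupp.mem_support_iff, Finsupp.mem_support_iff]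
        exact ⟨left_ne_zero_of_mul hx, left_ne_zero_of_mul (right_ne_zero_of_mul hx)⟩)
  nonneg := fun x => by
    have h1 := p.nonneg x.1
    have h2 := q.nonneg x.2
    have h3 := (p.map f).nonneg (f x.1)
    simp only [Finsupp.coe_zero, Pi.zero_apply, Finsupp.onFinset_apply] at *
    split_ifs <;> positivity
  total := by
    rw [Finsupp.onFinset_sum _ (fun _ => rfl), Finset.sum_product, ← expect_const p 1, expect_eq]
    apply Finset.sum_congr rfl
    intro a ha
    simp only [← Finset.mul_sum]
    congr 1
    have h1 := map_weights_apply q g (f a)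
    rw [← h] at h1
    have h2 : (p.map f).weights (f a) ≠ 0 := Finsupp.mem_support_iff.1 (mem_support_map f ha)
    rw [← mul_inv_cancel₀ h2, h1, expect_eq, Finset.sum_mul]
    apply Finset.sum_congr rfl
    intro b _
    split_ifs <;> simp

open Classical in
lemma expect_glue (p : Distribution S) (q : Distribution T) (f : S → C) (g : T → C)
    (h : p.map f = q.map g) (F : S × T → ℝ) :
    expect (glue p q f g h) F = expect p (fun a => expect q (fun b =>
      if g b = f a then ((p.map f).weights (f a))⁻¹ * F (a, b) else 0)) := by
  unfold expect glue
  rw [Finsupp.onFinset_sum _ (fun _ => by simp), Finset.sum_product]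
  simp only [Finsupp.sum, Finset.mul_sum, mul_assoc, ite_mul, zero_mul]

lemma glue_fst (p : Distribution S) (q : Distribution T) (f : S → C) (g : T → C)
    (h : p.map f = q.map g) : (glue p q f g h).map Prod.fst = p := by
  classical
  apply dist_ext
  intro F
  rw [expect_map, expect_glue]
  apply expect_congr
  intro a ha
  have h1 := map_weights_apply q g (f a)
  rw [← h] at h1
  have h2 : (p.map f).weights (f a) ≠ 0 := Finsupp.mem_support_iff.1 (mem_support_map f ha)
  have : expect q (fun b => if g b = f a then ((p.map f).weights (f a))⁻¹ * F a else 0)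
      = ((p.map f).weights (f a))⁻¹ * F a * expect q (fun b => if g b = f a then 1 else 0) := by
    rw [expect_eq, expect_eq, Finset.mul_sum]
    apply Finset.sum_congr rfl
    intro b _
    split_ifs <;> ring
  simp only [this, ← h1]
  field_simp

lemma expect_comm (p : Distribution S) (q : Distribution T) (F : S → T → ℝ) :
    expect p (fun a => expect q (fun b => F a b)) = expect q (fun b => expect p (fun a => F a b)) := by
  simp only [expect_eq, Finset.mul_sum]
  rw [Finset.sum_comm]
  refine Finset.sum_congr rfl fun _ _ => Finset.sum_congr rfl fun _ _ => by ring

lemma glue_snd (p : Distribution S) (q : Distribution T) (f : S → C) (g : T → C)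
    (h : p.map f = q.map g) : (glue p q f g h).map Prod.snd = q := by
  classical
  have key : (glue p q f g h).map Prod.swap = glue q p g f h.symm := by
    apply dist_ext
    intro F
    rw [expect_map, expect_glue, expect_glue, expect_comm]
    congr 1; ext b; congr 1; ext a
    by_cases hab : g b = f a
    · simp [hab, h]
    · simp [hab, Ne.symm hab]
  have h2 := glue_fst q p g f h.symm
  rw [← key, Convexity.StdSimplex.map_map] at h2
  exact h2

lemma glue_support (p : Distribution S) (q : Distribution T) (f : S → C) (g : T → C)
    (h : p.map f = q.map g) {x : S × T} (hx : x ∈ (glue p q f g h).weights.support) :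
    f x.1 = g x.2 := by
  classical
  by_contra hne
  apply Finsupp.mem_support_iff.1 hx
  simp [glue, Ne.symm hne]

lemma tensor_map_fst (p : Distribution S) (q : Distribution T) :
    (tensorDist p q).map Prod.fst = p := by
  apply dist_ext; intro F
  rw [expect_map, expect_tensor]
  simp [expect_const]

lemma tensor_map_snd (p : Distribution S) (q : Distribution T) :
    (tensorDist p q).map Prod.snd = q := by
  apply dist_ext; intro F
  rw [expect_map, expect_tensor]
  simp [expect_const]

lemma tensor_map_swap (p : Distribution S) (q : Distribution T) :
    (tensorDist p q).map Prod.swap = tensorDist q p := by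
  apply dist_ext; intro F
  rw [expect_map, expect_tensor, expect_tensor, expect_comm]
  rfl

lemma tensor_map_assoc (p : Distribution S) (q : Distribution T) (r : Distribution C) :
    (tensorDist (tensorDist p q) r).map (fun x => (x.1.1, (x.1.2, x.2)))
      = tensorDist p (tensorDist q r) := by
  apply dist_ext; intro F
  rw [expect_map, expect_tensor, expect_tensor, expect_tensor]
  simp only [expect_tensor]

lemma tensor_map_interchange {D : Type} (p : Distribution S) (q : Distribution T)
    (r : Distribution C) (s : Distribution D) :
    (tensorDist (tensorDist p q) (tensorDist r s)).map
        (fun x => ((x.1.1, x.2.1), (x.1.2, x.2.2)))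
      = tensorDist (tensorDist p r) (tensorDist q s) := by
  apply dist_ext; intro F
  rw [expect_map, expect_tensor, expect_tensor, expect_tensor, expect_tensor]
  simp only [expect_tensor]
  refine expect_congr p fun a _ => ?_
  rw [expect_comm]

/-- Submodularity of entropy. -/
lemma entropy_submod (c : Distribution (S × T)) (f : S → C) (g : T → C)
    (hfg : ∀ x ∈ c.weights.support, f x.1 = g x.2) :
    entropy c + entropy ((c.map Prod.fst).map f)
      ≤ entropy (c.map Prod.fst) + entropy (c.map Prod.snd) := by
  classical
  set p := c.map Prod.fst with hp
  set q := c.map Prod.snd with hq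
  have h : p.map f = q.map g := by
    rw [hp, hq, Convexity.StdSimplex.map_map, Convexity.StdSimplex.map_map]
    exact map_congr c hfg
  rw [entropy_eq c, entropy_eq (p.map f), entropy_eq p, entropy_eq q, expect_map p f]
  have e1 : ∀ F, expect p F = expect c (fun x => F x.1) := fun F => by rw [hp, expect_map]
  have e2 : ∀ F, expect q F = expect c (fun x => F x.2) := fun F => by rw [hq, expect_map]
  rw [e1, e1, e2, ← expect_add, ← expect_add]
  set G := glue p q f g h
  have hG : ∑ x ∈ c.weights.support, G.weights x ≤ 1 := by
    have h1 : ∑ x ∈ G.weights.support, G.weights x = 1 := G.total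
    rw [← h1]
    calc ∑ x ∈ c.weights.support, G.weights x
        ≤ ∑ x ∈ c.weights.support ∪ G.weights.support, G.weights x :=
          Finset.sum_le_sum_of_subset_of_nonneg Finset.subset_union_left fun x _ _ => G.nonneg x
      _ = ∑ x ∈ G.weights.support, G.weights x :=
          (Finset.sum_subset Finset.subset_union_right fun x _ hx =>
            Finsupp.notMem_support_iff.1 hx).symm
  have main : expect c (fun x => - Real.log (c.weights x) + - Real.log ((p.map f).weights (f x.1)))
      ≤ expect c (fun x => (G.weights x / c.weights x + -1)
        + (- Real.log (p.weights x.1) + - Real.log (q.weights x.2))) := by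
    apply expect_mono
    intro x hx
    have c0 := pos_of_mem hx
    have p0 : 0 < p.weights x.1 := c0.trans_le (le_map_weights c Prod.fst x)
    have q0 : 0 < q.weights x.2 := c0.trans_le (le_map_weights c Prod.snd x)
    have r0 : 0 < (p.map f).weights (f x.1) := p0.trans_le (le_map_weights p f x.1)
    have hGx : G.weights x = p.weights x.1 * (q.weights x.2 * ((p.map f).weights (f x.1))⁻¹) := by
      simp [G, glue, hfg x hx]
    have G0 : 0 < G.weights x := by rw [hGx]; positivity
    have h1 := Real.log_le_sub_one_of_pos (div_pos G0 c0)
    rw [Real.log_div G0.ne' c0.ne', hGx, Real.log_mul p0.ne' (by positivity),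
      Real.log_mul q0.ne' (by positivity), Real.log_inv, ← hGx] at h1
    linarith
  refine main.trans ?_
  rw [expect_add, expect_add, expect_const]
  have : expect c (fun x => G.weights x / c.weights x) ≤ 1 := by
    refine le_trans (le_of_eq ?_) hG
    rw [expect_eq]
    refine Finset.sum_congr rfl fun x hx => ?_
    have := (pos_of_mem hx).ne'
    field_simp
  linarith

end Distributions

/-! An indexing category is a finite poset `G` with binary meets; there is a (unique) morphism
`i ⟶ j` exactly when `i ≤ j`, so that ancestors are smaller elements, the minimal common ancestor
of `i` and `j` is `i ⊓ j`, and the initial object is `⊥`. -/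

/-- A `G`-diagram of finite probability spaces and reductions. The spaces are
`(space i, law i)`; a reduction is a class of measure-preserving maps modulo equality on the
support, and `map` gives a representative of each reduction. -/
structure Diagram (G : Type*) [PartialOrder G] where
  space : G → Type
  law : ∀ i, Distribution (space i)
  map : ∀ {i j : G}, i ≤ j → space i → space j
  map_law : ∀ {i j : G} (h : i ≤ j), (law i).map (map h) = law j
  map_refl : ∀ (i : G), ∀ x ∈ (law i).weights.support, map (le_refl i) x = x
  map_trans : ∀ {i j k : G} (h : i ≤ j) (h' : j ≤ k), ∀ x ∈ (law i).weights.support,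
    map h' (map h x) = map (h.trans h') x

/-- A reduction of `G`-diagrams (a natural transformation), given by representatives. -/
structure Reduction {G : Type*} [PartialOrder G] (X Y : Diagram G) where
  app : ∀ i, X.space i → Y.space i
  map_law : ∀ i, (X.law i).map (app i) = Y.law i
  naturality : ∀ {i j : G} (h : i ≤ j), ∀ x ∈ (X.law i).weights.support,
    app j (X.map h x) = Y.map h (app i x)

/-- A (two-)fan `X ← Z → Y` of `G`-diagrams. -/
structure Fan {G : Type*} [PartialOrder G] (X Y : Diagram G) where
  top : Diagram G
  left : Reduction top X
  right : Reduction top Y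

section Diagrams

variable {G : Type*} [PartialOrder G]

/-- The tensor product of diagrams. -/
noncomputable def Diagram.tensor (X Y : Diagram G) : Diagram G where
  space i := X.space i × Y.space i
  law i := tensorDist (X.law i) (Y.law i)
  map h := Prod.map (X.map h) (Y.map h)
  map_law h := by rw [map_tensor, X.map_law, Y.map_law]
  map_refl i x hx := by
    rw [mem_support_tensor] at hx
    exact Prod.ext (X.map_refl i _ hx.1) (Y.map_refl i _ hx.2)
  map_trans h h' x hx := by
    rw [mem_support_tensor] at hx
    exact Prod.ext (X.map_trans h h' _ hx.1) (Y.map_trans h h' _ hx.2)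

/-- The diagram all of whose spaces are one-point spaces. -/
noncomputable def Diagram.trivial (G : Type*) [PartialOrder G] : Diagram G where
  space _ := Unit
  law _ := Convexity.StdSimplex.single ()
  map _ := id
  map_law _ := by simp
  map_refl _ _ _ := rfl
  map_trans _ _ _ _ := rfl

/-- The tensor power `X ^ n`. -/
noncomputable def Diagram.pow (X : Diagram G) : ℕ → Diagram G
  | 0 => Diagram.trivial G
  | n + 1 => (X.pow n).tensor X

/-- The entropies of all spaces in a diagram. -/
noncomputable def Diagram.ent (X : Diagram G) (i : G) : ℝ := entropy (X.law i)

lemma Diagram.exists_map_bot_eq [OrderBot G] (X : Diagram G) {i : G} {u : X.space i}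
    (hu : u ∈ (X.law i).weights.support) :
    ∃ x ∈ (X.law ⊥).weights.support, X.map (bot_le : ⊥ ≤ i) x = u := by
  rw [← X.map_law (bot_le : ⊥ ≤ i)] at hu
  exact exists_of_mem_support_map hu

/-- The initial space `X_⊥` conditioned on an atom `u` of `X_ι`. -/
noncomputable def Diagram.condInitialLaw [OrderBot G] (X : Diagram G) (ι : G)
    (u : (X.law ι).weights.support) : Distribution (X.space ⊥) :=
  (X.law ⊥).restrict (X.map (bot_le : ⊥ ≤ ι) ⁻¹' {(u : X.space ι)}) (by
    obtain ⟨x, hx, hxu⟩ := X.exists_map_bot_eq u.2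
    exact ⟨x, hxu, Finsupp.mem_support_iff.1 hx⟩)

lemma Diagram.condInitialLaw_support [OrderBot G] (X : Diagram G) (ι : G)
    (u : (X.law ι).weights.support) {x : X.space ⊥}
    (hx : x ∈ (X.condInitialLaw ι u).weights.support) : x ∈ (X.law ⊥).weights.support := by
  classical
  unfold Diagram.condInitialLaw at hx
  rw [Convexity.StdSimplex.support_weights_restrict] at hx
  exact (Finset.mem_filter.1 hx).1

lemma Diagram.map_bot_support [OrderBot G] (X : Diagram G) {i : G} {x : X.space ⊥}
    (hx : x ∈ (X.law ⊥).weights.support) :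
    X.map (bot_le : ⊥ ≤ i) x ∈ (X.law i).weights.support := by
  rw [← X.map_law (bot_le : ⊥ ≤ i)]
  exact mem_support_map _ hx

/-- The conditioned diagram `X | u`, for an atom `u` of the space `X_ι`: the underlying sets and
maps are those of `X`, and the distributions are the images of the conditioned distribution of the
initial space. -/
noncomputable def Diagram.cond [OrderBot G] (X : Diagram G) (ι : G)
    (u : (X.law ι).weights.support) : Diagram G where
  space := X.space
  law i := (X.condInitialLaw ι u).map (X.map (bot_le : ⊥ ≤ i))
  map := X.map
  map_law h := by
    rw [Convexity.StdSimplex.map_map]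
    exact map_congr _ fun x hx => X.map_trans _ h x (X.condInitialLaw_support ι u hx)
  map_refl i x hx := by
    obtain ⟨y, hy, rfl⟩ := exists_of_mem_support_map hx
    exact X.map_refl i _ (X.map_bot_support (X.condInitialLaw_support ι u hy))
  map_trans h h' x hx := by
    obtain ⟨y, hy, rfl⟩ := exists_of_mem_support_map hx
    exact X.map_trans h h' _ (X.map_bot_support (X.condInitialLaw_support ι u hy))

/-- Reductions of diagrams map the support to the support. -/
lemma Reduction.mem_support {X Y : Diagram G} (f : Reduction X Y) {i : G} {x : X.space i}
    (hx : x ∈ (X.law i).weights.support) : f.app i x ∈ (Y.law i).weights.support := by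
  rw [← f.map_law i]
  exact mem_support_map _ hx

/-- The identity reduction. -/
def Reduction.refl (X : Diagram G) : Reduction X X where
  app _ := id
  map_law _ := by simp
  naturality _ _ _ := rfl

/-- The composition of two reductions. -/
def Reduction.comp {X Y Z : Diagram G} (f : Reduction X Y) (g : Reduction Y Z) :
    Reduction X Z where
  app i := g.app i ∘ f.app i
  map_law i := by rw [Convexity.StdSimplex.map_comp, f.map_law, g.map_law]
  naturality h x hx := by
    simp only [Function.comp]
    rw [f.naturality h x hx, g.naturality h _ (f.mem_support hx)]

/-- The tensor product of two reductions. -/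
def Reduction.tensor {X Y X' Y' : Diagram G} (f : Reduction X X') (g : Reduction Y Y') :
    Reduction (X.tensor Y) (X'.tensor Y') where
  app i := Prod.map (f.app i) (g.app i)
  map_law i := (map_tensor (X.law i) (Y.law i) (f.app i) (g.app i)).trans
    (by rw [f.map_law, g.map_law]; rfl)
  naturality h x hx := by
    have hx' := mem_support_tensor.1 hx
    exact Prod.ext (f.naturality h _ hx'.1) (g.naturality h _ hx'.2)

/-- The projection of a tensor product. -/
def Reduction.fst (X Y : Diagram G) : Reduction (X.tensor Y) X where
  app _ := Prod.fst
  map_law _ := tensor_map_fst _ _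
  naturality _ _ _ := rfl

/-- The projection of a tensor product. -/
def Reduction.snd (X Y : Diagram G) : Reduction (X.tensor Y) Y where
  app _ := Prod.snd
  map_law _ := tensor_map_snd _ _
  naturality _ _ _ := rfl

/-- The symmetry of the tensor product. -/
def Reduction.swap (X Y : Diagram G) : Reduction (X.tensor Y) (Y.tensor X) where
  app _ := Prod.swap
  map_law _ := tensor_map_swap _ _
  naturality _ _ _ := rfl

/-- The associativity of the tensor product. -/
def Reduction.assoc (X Y Z : Diagram G) :
    Reduction ((X.tensor Y).tensor Z) (X.tensor (Y.tensor Z)) where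
  app _ := fun x => (x.1.1, (x.1.2, x.2))
  map_law _ := tensor_map_assoc _ _ _
  naturality _ _ _ := rfl

/-- The interchange of factors in a tensor product. -/
def Reduction.interchange (X Y Z W : Diagram G) :
    Reduction ((X.tensor Y).tensor (Z.tensor W)) ((X.tensor Z).tensor (Y.tensor W)) where
  app _ := fun x => ((x.1.1, x.2.1), (x.1.2, x.2.2))
  map_law _ := tensor_map_interchange _ _ _ _
  naturality _ _ _ := rfl

lemma Reduction.ent_le {X Y : Diagram G} (f : Reduction X Y) (i : G) : Y.ent i ≤ X.ent i := by
  unfold Diagram.ent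
  rw [← f.map_law i]
  exact entropy_map_le _ _

lemma Diagram.ent_tensor (X Y : Diagram G) (i : G) :
    (X.tensor Y).ent i = X.ent i + Y.ent i := entropy_tensor _ _

lemma Diagram.ent_trivial (i : G) : (Diagram.trivial G).ent i = 0 := by
  simp [Diagram.ent, Diagram.trivial, entropy]

variable [OrderBot G]

/-- The composition of two fans. -/
noncomputable def Fan.compTop {X Y Z : Diagram G} (K : Fan X Y) (L : Fan Y Z) : Diagram G where
  space i := K.top.space i × L.top.space i
  law i := (glue (K.top.law ⊥) (L.top.law ⊥) (K.right.app ⊥) (L.left.app ⊥)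
    (by rw [K.right.map_law, L.left.map_law])).map
      (Prod.map (K.top.map (bot_le : ⊥ ≤ i)) (L.top.map (bot_le : ⊥ ≤ i)))
  map h := Prod.map (K.top.map h) (L.top.map h)
  map_law h := by
    rw [Convexity.StdSimplex.map_map]
    refine map_congr _ fun x hx => ?_
    have h1 := mem_support_map Prod.fst hx
    have h2 := mem_support_map Prod.snd hx
    rw [glue_fst] at h1
    rw [glue_snd] at h2
    exact Prod.ext (K.top.map_trans _ h _ h1) (L.top.map_trans _ h _ h2)
  map_refl i x hx := by
    obtain ⟨y, hy, rfl⟩ := exists_of_mem_support_map hx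
    have h1 := mem_support_map Prod.fst hy
    have h2 := mem_support_map Prod.snd hy
    rw [glue_fst] at h1
    rw [glue_snd] at h2
    exact Prod.ext (K.top.map_refl i _ (K.top.map_bot_support h1))
      (L.top.map_refl i _ (L.top.map_bot_support h2))
  map_trans h h' x hx := by
    obtain ⟨y, hy, rfl⟩ := exists_of_mem_support_map hx
    have h1 := mem_support_map Prod.fst hy
    have h2 := mem_support_map Prod.snd hy
    rw [glue_fst] at h1
    rw [glue_snd] at h2
    exact Prod.ext (K.top.map_trans h h' _ (K.top.map_bot_support h1))
      (L.top.map_trans h h' _ (L.top.map_bot_support h2))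

lemma Fan.compTop_fst {X Y Z : Diagram G} (K : Fan X Y) (L : Fan Y Z) (i : G) :
    ((K.compTop L).law i).map Prod.fst = K.top.law i := by
  unfold Fan.compTop
  rw [Convexity.StdSimplex.map_map, ← K.top.map_law (bot_le : ⊥ ≤ i)]
  conv_rhs => rw [← glue_fst (K.top.law ⊥) (L.top.law ⊥) (K.right.app ⊥) (L.left.app ⊥)
    (by rw [K.right.map_law, L.left.map_law]), Convexity.StdSimplex.map_map]
  rfl

lemma Fan.compTop_snd {X Y Z : Diagram G} (K : Fan X Y) (L : Fan Y Z) (i : G) :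
    ((K.compTop L).law i).map Prod.snd = L.top.law i := by
  unfold Fan.compTop
  rw [Convexity.StdSimplex.map_map, ← L.top.map_law (bot_le : ⊥ ≤ i)]
  conv_rhs => rw [← glue_snd (K.top.law ⊥) (L.top.law ⊥) (K.right.app ⊥) (L.left.app ⊥)
    (by rw [K.right.map_law, L.left.map_law]), Convexity.StdSimplex.map_map]
  rfl

end Diagrams

section EntropyDistance

variable {G : Type*} [PartialOrder G] [Fintype G]

/-- The entropy distance of a fan. -/
noncomputable def Fan.kd {X Y : Diagram G} (K : Fan X Y) : ℝ :=
  ∑ i, |K.top.ent i - X.ent i| + ∑ i, |K.top.ent i - Y.ent i|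

/-- The intrinsic entropy distance. -/
noncomputable def ikd (X Y : Diagram G) : ℝ := ⨅ K : Fan X Y, K.kd

/-- The asymptotic entropy distance `lim (1/n) ikd(X ^ n, Y ^ n)`. -/
noncomputable def aikd (X Y : Diagram G) : ℝ :=
  limUnder atTop fun n : ℕ => ikd (X.pow n) (Y.pow n) / n

lemma Fan.kd_nonneg {X Y : Diagram G} (K : Fan X Y) : 0 ≤ K.kd :=
  add_nonneg (Finset.sum_nonneg fun _ _ => abs_nonneg _) (Finset.sum_nonneg fun _ _ => abs_nonneg _)

lemma Fan.kd_eq {X Y : Diagram G} (K : Fan X Y) :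
    K.kd = ∑ i, (2 * K.top.ent i - X.ent i - Y.ent i) := by
  unfold Fan.kd
  rw [← Finset.sum_add_distrib]
  refine Finset.sum_congr rfl fun i _ => ?_
  rw [abs_of_nonneg (sub_nonneg.2 (K.left.ent_le i)), abs_of_nonneg (sub_nonneg.2 (K.right.ent_le i))]
  ring

instance (X Y : Diagram G) : Nonempty (Fan X Y) :=
  ⟨⟨X.tensor Y, Reduction.fst X Y, Reduction.snd X Y⟩⟩

lemma ikd_le {X Y : Diagram G} (K : Fan X Y) : ikd X Y ≤ K.kd :=
  ciInf_le ⟨0, by rintro _ ⟨K, rfl⟩; exact K.kd_nonneg⟩ K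

lemma ikd_nonneg (X Y : Diagram G) : 0 ≤ ikd X Y := Real.iInf_nonneg fun K => K.kd_nonneg

lemma ikd_symm (X Y : Diagram G) : ikd X Y = ikd Y X := by
  have : ∀ X Y : Diagram G, ikd X Y ≤ ikd Y X := by
    intro X Y
    refine le_ciInf fun K => ?_
    refine (ikd_le ⟨K.top, K.right, K.left⟩).trans (le_of_eq ?_)
    unfold Fan.kd
    ring
  exact le_antisymm (this _ _) (this _ _)

lemma ikd_eq_zero {X Y : Diagram G} (f : Reduction X Y) (h : ∀ i, X.ent i = Y.ent i) :
    ikd X Y = 0 := by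
  refine le_antisymm ((ikd_le ⟨X, Reduction.refl X, f⟩).trans (le_of_eq ?_)) (ikd_nonneg _ _)
  simp [Fan.kd, h]

lemma ikd_self (X : Diagram G) : ikd X X = 0 := ikd_eq_zero (Reduction.refl X) fun _ => rfl

lemma ikd_tensor_le (X Y X' Y' : Diagram G) :
    ikd (X.tensor Y) (X'.tensor Y') ≤ ikd X X' + ikd Y Y' := by
  unfold ikd
  refine le_ciInf_add_ciInf fun K L => ?_
  refine (ikd_le ⟨K.top.tensor L.top, K.left.tensor L.left, K.right.tensor L.right⟩).trans ?_
  rw [Fan.kd_eq, Fan.kd_eq, Fan.kd_eq, ← Finset.sum_add_distrib]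
  refine Finset.sum_le_sum fun i _ => ?_
  simp only [Diagram.ent_tensor]
  linarith

lemma ikd_comm (X Y : Diagram G) : ikd (X.tensor Y) (Y.tensor X) = 0 :=
  ikd_eq_zero (Reduction.swap X Y) fun i => by simp only [Diagram.ent_tensor]; ring

lemma ikd_assoc (X Y Z : Diagram G) :
    ikd ((X.tensor Y).tensor Z) (X.tensor (Y.tensor Z)) = 0 :=
  ikd_eq_zero (Reduction.assoc X Y Z) fun i => by simp only [Diagram.ent_tensor]; ring

lemma ikd_tensor_trivial (X : Diagram G) : ikd (X.tensor (Diagram.trivial G)) X = 0 :=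
  ikd_eq_zero (Reduction.fst X _) fun i => by simp [Diagram.ent_tensor, Diagram.ent_trivial]

variable [OrderBot G]

lemma ikd_triangle (X Y Z : Diagram G) : ikd X Z ≤ ikd X Y + ikd Y Z := by
  unfold ikd
  refine le_ciInf_add_ciInf fun K L => ?_
  let p1 : Reduction (K.compTop L) K.top := ⟨fun _ => Prod.fst, K.compTop_fst L, fun _ _ _ => rfl⟩
  let p2 : Reduction (K.compTop L) L.top := ⟨fun _ => Prod.snd, K.compTop_snd L, fun _ _ _ => rfl⟩
  refine (ikd_le ⟨K.compTop L, p1.comp K.left, p2.comp L.right⟩).trans ?_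
  rw [Fan.kd_eq, Fan.kd_eq, Fan.kd_eq, ← Finset.sum_add_distrib]
  refine Finset.sum_le_sum fun i _ => ?_
  have key : (K.compTop L).ent i + Y.ent i ≤ K.top.ent i + L.top.ent i := by
    have := entropy_submod ((K.compTop L).law i) (K.right.app i) (L.left.app i) (by
      intro x hx
      obtain ⟨y, hy, rfl⟩ := exists_of_mem_support_map (p := glue _ _ _ _ _) hx
      have h1 := mem_support_map Prod.fst hy
      have h2 := mem_support_map Prod.snd hy
      have h3 := glue_support _ _ _ _ _ hy
      rw [glue_fst] at h1
      rw [glue_snd] at h2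
      simp only [Prod.map]
      rw [K.right.naturality _ _ h1, L.left.naturality _ _ h2, h3])
    rw [K.compTop_fst L, K.compTop_snd L, K.right.map_law] at this
    exact this
  simp only
  linarith

end EntropyDistance

section AsymptoticDistance

variable {G : Type*} [PartialOrder G] [Fintype G] [OrderBot G]

lemma ikd_zero_trans {X Y Z : Diagram G} (h : ikd X Y = 0) (h' : ikd Y Z = 0) : ikd X Z = 0 :=
  le_antisymm ((ikd_triangle X Y Z).trans (by rw [h, h', add_zero])) (ikd_nonneg _ _)

lemma ikd_zero_tensor {X Y X' Y' : Diagram G} (h : ikd X X' = 0) (h' : ikd Y Y' = 0) :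
    ikd (X.tensor Y) (X'.tensor Y') = 0 :=
  le_antisymm ((ikd_tensor_le X Y X' Y').trans (by rw [h, h', add_zero])) (ikd_nonneg _ _)

lemma ikd_le_of_zero {X Y X' Y' : Diagram G} (h : ikd X X' = 0) (h' : ikd Y Y' = 0) :
    ikd X Y ≤ ikd X' Y' := by
  have h1 := ikd_triangle X X' Y
  have h2 := ikd_triangle X' Y' Y
  rw [ikd_symm Y' Y] at h2
  linarith

lemma ikd_pow_add (X : Diagram G) (m n : ℕ) :
    ikd (X.pow (m + n)) ((X.pow m).tensor (X.pow n)) = 0 := by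
  induction n with
  | zero => rw [ikd_symm]; exact ikd_tensor_trivial _
  | succ n ih => exact ikd_zero_trans (ikd_zero_tensor ih (ikd_self X)) (ikd_assoc _ _ _)

lemma ikd_interchange (X Y Z W : Diagram G) :
    ikd ((X.tensor Y).tensor (Z.tensor W)) ((X.tensor Z).tensor (Y.tensor W)) = 0 :=
  ikd_eq_zero (Reduction.interchange X Y Z W) fun i => by simp only [Diagram.ent_tensor]; ring

lemma ikd_tensor_pow (X Y : Diagram G) (n : ℕ) :
    ikd ((X.tensor Y).pow n) ((X.pow n).tensor (Y.pow n)) = 0 := by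
  induction n with
  | zero => rw [ikd_symm]; exact ikd_tensor_trivial _
  | succ n ih => exact ikd_zero_trans (ikd_zero_tensor ih (ikd_self _)) (ikd_interchange _ _ _ _)

lemma ikd_pow_le (X Y : Diagram G) (n : ℕ) : ikd (X.pow n) (Y.pow n) ≤ n * ikd X Y := by
  induction n with
  | zero =>
    rw [Nat.cast_zero, zero_mul]
    exact (ikd_self (Diagram.trivial G)).le
  | succ n ih =>
    refine (ikd_tensor_le _ _ _ _).trans ?_
    push_cast
    linarith

lemma aikd_subadditive (X Y : Diagram G) : Subadditive fun n => ikd (X.pow n) (Y.pow n) :=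
  fun m n => (ikd_le_of_zero (ikd_pow_add X m n) (ikd_pow_add Y m n)).trans (ikd_tensor_le _ _ _ _)

/-- The limit in the definition of `aikd` exists. -/
lemma tendsto_aikd (X Y : Diagram G) :
    Tendsto (fun n : ℕ => ikd (X.pow n) (Y.pow n) / n) atTop (𝓝 (aikd X Y)) :=
  tendsto_nhds_limUnder ⟨_, (aikd_subadditive X Y).tendsto_lim
    ⟨0, by rintro _ ⟨n, rfl⟩; exact div_nonneg (ikd_nonneg _ _) n.cast_nonneg⟩⟩

lemma aikd_nonneg (X Y : Diagram G) : 0 ≤ aikd X Y :=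
  ge_of_tendsto' (tendsto_aikd X Y) fun n => div_nonneg (ikd_nonneg _ _) n.cast_nonneg

lemma aikd_le_ikd (X Y : Diagram G) : aikd X Y ≤ ikd X Y := by
  refine le_of_tendsto (tendsto_aikd X Y) ?_
  filter_upwards [eventually_gt_atTop 0] with n hn
  rw [div_le_iff₀ (by exact_mod_cast hn), mul_comm]
  exact ikd_pow_le X Y n

lemma aikd_eq_zero {X Y : Diagram G} (h : ikd X Y = 0) : aikd X Y = 0 :=
  le_antisymm ((aikd_le_ikd X Y).trans h.le) (aikd_nonneg X Y)

lemma aikd_self (X : Diagram G) : aikd X X = 0 := aikd_eq_zero (ikd_self X)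

lemma aikd_symm (X Y : Diagram G) : aikd X Y = aikd Y X := by
  unfold aikd
  simp only [ikd_symm]

lemma aikd_triangle (X Y Z : Diagram G) : aikd X Z ≤ aikd X Y + aikd Y Z := by
  refine le_of_tendsto_of_tendsto' (tendsto_aikd X Z)
    ((tendsto_aikd X Y).add (tendsto_aikd Y Z)) fun n => ?_
  rw [← add_div]
  exact div_le_div_of_nonneg_right (ikd_triangle _ _ _) n.cast_nonneg

lemma aikd_tensor_le (X Y X' Y' : Diagram G) :
    aikd (X.tensor Y) (X'.tensor Y') ≤ aikd X X' + aikd Y Y' := by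
  refine le_of_tendsto_of_tendsto' (tendsto_aikd _ _)
    ((tendsto_aikd X X').add (tendsto_aikd Y Y')) fun n => ?_
  rw [← add_div]
  exact div_le_div_of_nonneg_right ((ikd_le_of_zero (ikd_tensor_pow _ _ _)
    (ikd_tensor_pow _ _ _)).trans (ikd_tensor_le _ _ _ _)) n.cast_nonneg

end AsymptoticDistance

/-- A positive admissible function `[1, ∞) → (0, ∞)`; only the values on `[1, ∞)` matter. -/
structure AdmissibleFunction where
  toFun : ℝ → ℝ
  pos : ∀ t, 1 ≤ t → 0 < toFun t
  mono : MonotoneOn toFun (Set.Ici 1)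
  integrable : MeasureTheory.IntegrableOn (fun s => toFun s / s ^ 2) (Set.Ioi 1)
  bound : ∃ D : ℝ, ∀ t, 1 ≤ t → 8 * t * (∫ s in Set.Ioi t, toFun s / s ^ 2) ≤ D * toFun t

namespace AdmissibleFunction

variable (φ : AdmissibleFunction)

/-- The tail integrals of an admissible function (a tool for the proofs below). -/
noncomputable def tail (t : ℝ) : ℝ := ∫ s in Set.Ioi t, φ.toFun s / s ^ 2

lemma tail_sub {s t : ℝ} (hs : 1 ≤ s) (hst : s ≤ t) :
    φ.toFun s * ((t - s) / t ^ 2) ≤ φ.tail s - φ.tail t := by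
  have i1 : MeasureTheory.IntegrableOn (fun s => φ.toFun s / s ^ 2) (Set.Ioc s t) :=
    φ.integrable.mono_set (fun x hx => hs.trans_lt hx.1)
  have i2 : MeasureTheory.IntegrableOn (fun s => φ.toFun s / s ^ 2) (Set.Ioi t) :=
    φ.integrable.mono_set (fun x hx => (hs.trans hst).trans_lt hx)
  have h : φ.tail s = (∫ x in Set.Ioc s t, φ.toFun x / x ^ 2) + φ.tail t := by
    unfold tail
    rw [← Set.Ioc_union_Ioi_eq_Ioi hst, MeasureTheory.setIntegral_union
      (Set.Ioc_disjoint_Ioi le_rfl) measurableSet_Ioi i1 i2]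
  have h2 : (∫ _ in Set.Ioc s t, φ.toFun s / t ^ 2) ≤ ∫ x in Set.Ioc s t, φ.toFun x / x ^ 2 := by
    refine MeasureTheory.setIntegral_mono_on (by simp) i1 measurableSet_Ioc fun x hx => ?_
    have hx0 : 0 < x := by linarith [hx.1]
    have h0 := φ.pos s hs
    have hm : φ.toFun s ≤ φ.toFun x := φ.mono hs (hs.trans hx.1.le) hx.1.le
    have := hx.2
    have h1 := h0.le.trans hm
    gcongr
  rw [MeasureTheory.setIntegral_const] at h2
  simp only [MeasureTheory.measureReal_def, Real.volume_Ioc, smul_eq_mul,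
    ENNReal.toReal_ofReal (sub_nonneg.2 hst)] at h2
  rw [h]
  have : φ.toFun s * ((t - s) / t ^ 2) = (t - s) * (φ.toFun s / t ^ 2) := by ring
  linarith

lemma tail_anti {s t : ℝ} (hs : 1 ≤ s) (hst : s ≤ t) : φ.tail t ≤ φ.tail s := by
  have h1 := φ.tail_sub hs hst
  have h2 := φ.pos s hs
  have h3 : 0 ≤ φ.toFun s * ((t - s) / t ^ 2) := by
    have := sub_nonneg.2 hst
    positivity
  linarith

lemma tail_nonneg {t : ℝ} (ht : 1 ≤ t) : 0 ≤ φ.tail t :=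
  MeasureTheory.setIntegral_nonneg measurableSet_Ioi fun x hx =>
    div_nonneg (φ.pos x (ht.trans (le_of_lt hx))).le (sq_nonneg x)

lemma tail_step {t : ℝ} (ht : 1 ≤ t) :
    φ.toFun t / t * (2 / 9) ≤ φ.tail t - φ.tail (3 / 2 * t) := by
  have h := φ.tail_sub ht (by linarith : t ≤ 3 / 2 * t)
  refine le_trans (le_of_eq ?_) h
  field_simp
  norm_num

lemma tail_tendsto : Tendsto (fun n : ℕ => φ.tail n) atTop (𝓝 0) := by
  have h := MeasureTheory.intervalIntegral_tendsto_integral_Ioi 1 φ.integrable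
    (tendsto_natCast_atTop_atTop (R := ℝ))
  have h2 := (tendsto_const_nhds (x := φ.tail 1)).sub h
  have e : φ.tail 1 - ∫ x in Set.Ioi (1 : ℝ), φ.toFun x / x ^ 2 = 0 := sub_self _
  rw [e] at h2
  refine h2.congr' ?_
  filter_upwards [eventually_ge_atTop 1] with n hn
  have hn' : (1 : ℝ) ≤ n := by exact_mod_cast hn
  rw [intervalIntegral.integral_of_le hn']
  unfold tail
  rw [← Set.Ioc_union_Ioi_eq_Ioi hn', MeasureTheory.setIntegral_union
      (Set.Ioc_disjoint_Ioi le_rfl) measurableSet_Ioi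
      (φ.integrable.mono_set (fun x hx => hx.1))
      (φ.integrable.mono_set (fun x hx => hn'.trans_lt hx))]
  ring

lemma div_tendsto : Tendsto (fun n : ℕ => φ.toFun n / n) atTop (𝓝 0) := by
  have h := φ.tail_tendsto.mul_const (9 / 2)
  rw [zero_mul] at h
  refine tendsto_of_tendsto_of_tendsto_of_le_of_le' tendsto_const_nhds h ?_ ?_
  · filter_upwards [eventually_ge_atTop 1] with n hn
    have hn' : (1 : ℝ) ≤ n := by exact_mod_cast hn
    exact div_nonneg (φ.pos _ hn').le (by positivity)
  · filter_upwards [eventually_ge_atTop 1] with n hn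
    have hn' : (1 : ℝ) ≤ n := by exact_mod_cast hn
    have h1 := φ.tail_step hn'
    have h2 := φ.tail_nonneg (by linarith : (1 : ℝ) ≤ 3 / 2 * n)
    linarith

lemma exists_scale (K : ℝ) (hK : 1 ≤ K) :
    ∃ C, 0 ≤ C ∧ ∀ t, 1 ≤ t → φ.toFun (K * t) ≤ C * φ.toFun t := by
  obtain ⟨D, hD⟩ := φ.bound
  refine ⟨|9 / 16 * K * D|, abs_nonneg _, fun t ht => ?_⟩
  have hKt : t ≤ K * t := by nlinarith
  have h1 := φ.tail_step (ht.trans hKt)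
  have h2 := φ.tail_nonneg (by linarith : (1 : ℝ) ≤ 3 / 2 * (K * t))
  have h3 := φ.tail_anti ht hKt
  have h4 : 8 * t * φ.tail t ≤ D * φ.toFun t := hD t ht
  have h5 : φ.toFun (K * t) / (K * t) * (2 / 9) ≤ φ.tail t := by linarith
  have h6 : 8 * t * (φ.toFun (K * t) / (K * t) * (2 / 9)) ≤ D * φ.toFun t :=
    (mul_le_mul_of_nonneg_left h5 (by linarith)).trans h4
  have h7 : 8 * t * (φ.toFun (K * t) / (K * t) * (2 / 9)) = φ.toFun (K * t) * (16 / (9 * K)) := by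
    have : K ≠ 0 := by linarith
    have : t ≠ 0 := by linarith
    field_simp
    ring
  rw [h7] at h6
  have h8 : φ.toFun (K * t) ≤ 9 / 16 * K * D * φ.toFun t := by
    have hK0 : 0 < K := by linarith
    have := mul_le_mul_of_nonneg_left h6 (by positivity : 0 ≤ 9 / 16 * K)
    refine le_trans (le_of_eq ?_) (this.trans (le_of_eq ?_))
    · field_simp
    · ring
  exact h8.trans (mul_le_mul_of_nonneg_right (le_abs_self _) (φ.pos t ht).le)

/-- A subadditivity lemma with an admissible error term. -/
lemma subadditive_mul {a : ℕ → ℝ} {C : ℝ} (hC : 0 ≤ C)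
    (ha : ∀ n m, 1 ≤ n → 1 ≤ m → a (n + m) ≤ a n + a m + C * φ.toFun ((n + m : ℕ) : ℝ))
    (m : ℕ) (hm : 1 ≤ m) (n : ℕ) (hn : 1 ≤ n) :
    a (m * n) ≤ n * a m +
      9 / 2 * C * (m * n) * (φ.tail m - φ.tail (3 / 2 * (m * n))) := by
  have hm' : (1 : ℝ) ≤ m := by exact_mod_cast hm
  induction n using Nat.strong_induction_on with
  | _ n ih =>
    rcases Nat.lt_or_ge n 2 with h | h
    · obtain rfl : n = 1 := by omega
      have := φ.tail_anti hm' (by linarith : (m : ℝ) ≤ 3 / 2 * (m * 1))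
      simp only [mul_one, Nat.cast_one, one_mul] at *
      have h2 : 0 ≤ 9 / 2 * C * m * (φ.tail m - φ.tail (3 / 2 * m)) :=
        mul_nonneg (by positivity) (by linarith)
      linarith
    · obtain ⟨p, q, hpq, hp, hq, hp3, hq3⟩ : ∃ p q, p + q = n ∧ 1 ≤ p ∧ 1 ≤ q ∧
          3 * p ≤ 2 * n ∧ 3 * q ≤ 2 * n := ⟨n / 2, n - n / 2, by omega, by omega, by omega,
            by omega, by omega⟩
      have i1 := ih p (by omega) hp
      have i2 := ih q (by omega) hq
      have hs := ha (m * p) (m * q) (Nat.mul_pos hm hp) (Nat.mul_pos hm hq)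
      have e : m * p + m * q = m * n := by rw [← hpq]; ring
      rw [e] at hs
      have hN : (1 : ℝ) ≤ m * n := by
        have : 1 ≤ m * n := Nat.mul_pos hm (by omega)
        exact_mod_cast this
      have hn' : (n : ℝ) = p + q := by rw [← hpq]; push_cast; ring
      have hp' : (1 : ℝ) ≤ p := by exact_mod_cast hp
      have hq' : (1 : ℝ) ≤ q := by exact_mod_cast hq
      have hp3' : (3 : ℝ) * p ≤ 2 * n := by exact_mod_cast hp3
      have hq3' : (3 : ℝ) * q ≤ 2 * n := by exact_mod_cast hq3
      have t1 := φ.tail_anti (s := 3 / 2 * (m * p)) (t := m * n) (by nlinarith) (by nlinarith)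
      have t2 := φ.tail_anti (s := 3 / 2 * (m * q)) (t := m * n) (by nlinarith) (by nlinarith)
      have st := φ.tail_step hN
      push_cast at hs
      set F := φ.tail
      set N : ℝ := m * n
      have eN : N = m * p + m * q := by simp only [N]; rw [hn']; ring
      have j1 : 9 / 2 * C * (m * p) * (F m - F (3 / 2 * (m * p)))
          ≤ 9 / 2 * C * (m * p) * (F m - F N) :=
        mul_le_mul_of_nonneg_left (by linarith) (by positivity)
      have j2 : 9 / 2 * C * (m * q) * (F m - F (3 / 2 * (m * q)))
          ≤ 9 / 2 * C * (m * q) * (F m - F N) :=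
        mul_le_mul_of_nonneg_left (by linarith) (by positivity)
      have j3 : C * φ.toFun N ≤ 9 / 2 * C * N * (F N - F (3 / 2 * N)) := by
        have := mul_le_mul_of_nonneg_left st (by positivity : 0 ≤ 9 / 2 * C * N)
        refine le_trans (le_of_eq ?_) this
        field_simp
      have hfin : (n : ℝ) * a m + 9 / 2 * C * N * (F m - F (3 / 2 * N))
          = (p * a m + 9 / 2 * C * (m * p) * (F m - F N))
            + (q * a m + 9 / 2 * C * (m * q) * (F m - F N))
            + 9 / 2 * C * N * (F N - F (3 / 2 * N)) := by
        rw [hn', eN]; ring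
      rw [hfin]
      linarith

/-- Fekete's lemma with an admissible error term. -/
lemma exists_tendsto {a : ℕ → ℝ} {C : ℝ} (hC : 0 ≤ C) (h0 : ∀ n, 0 ≤ a n)
    (ha : ∀ n m, 1 ≤ n → 1 ≤ m → a (n + m) ≤ a n + a m + C * φ.toFun ((n + m : ℕ) : ℝ)) :
    ∃ l, Tendsto (fun n : ℕ => a n / n) atTop (𝓝 l) := by
  set b : ℕ → ℝ := fun m => a m / m + 9 / 2 * C * φ.tail m with hb
  have b0 : ∀ m, 1 ≤ m → 0 ≤ b m := fun m hm =>
    add_nonneg (div_nonneg (h0 m) m.cast_nonneg)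
      (mul_nonneg (by positivity) (φ.tail_nonneg (by exact_mod_cast hm)))
  set L := sInf (b '' Set.Ici 1) with hL
  have hLb : ∀ m, 1 ≤ m → L ≤ b m := fun m hm =>
    csInf_le ⟨0, by rintro _ ⟨k, hk, rfl⟩; exact b0 k hk⟩ ⟨m, hm, rfl⟩
  have upper : ∀ m, 1 ≤ m → ∀ ε > 0, ∀ᶠ N : ℕ in atTop, a N / N ≤ b m + ε := by
    intro m hm ε hε
    set M := ∑ r ∈ Finset.range m, a r
    have hM : ∀ r, r < m → a r ≤ M := fun r hr =>
      Finset.single_le_sum (fun i _ => h0 i) (Finset.mem_range.2 hr)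
    have lim : Tendsto (fun N : ℕ => M / N + C * (φ.toFun N / N)) atTop (𝓝 0) := by
      have h1 : Tendsto (fun N : ℕ => M / (N : ℝ)) atTop (𝓝 0) :=
        tendsto_const_div_atTop_nhds_zero_nat M
      have h2 := h1.add (φ.div_tendsto.const_mul C)
      simpa using h2
    filter_upwards [lim.eventually (gt_mem_nhds hε), eventually_ge_atTop m] with N hN hNm
    have hN1 : 1 ≤ N := hm.trans hNm
    have hN0 : (0 : ℝ) < N := by exact_mod_cast hN1
    have hm0 : (1 : ℝ) ≤ m := by exact_mod_cast hm
    have hq : 1 ≤ N / m := (Nat.one_le_div_iff hm).2 hNm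
    have key := φ.subadditive_mul hC ha m hm (N / m) hq
    have hdm := Nat.div_add_mod N m
    have hr := Nat.mod_lt N hm
    set q := N / m
    set r := N % m
    have haN : a N ≤ a (m * q) + M + C * φ.toFun N := by
      have hφ := (φ.pos N (by exact_mod_cast hN1)).le
      have hCφ : 0 ≤ C * φ.toFun N := mul_nonneg hC hφ
      rcases Nat.eq_zero_or_pos r with h | h
      · have hMn : 0 ≤ M := Finset.sum_nonneg fun i _ => h0 i
        rw [h, add_zero] at hdm
        rw [hdm]; linarith
      · have := ha (m * q) r (Nat.mul_pos hm hq) h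
        rw [hdm] at this
        linarith [hM r hr]
    have hqN : (m : ℝ) * q ≤ N := by exact_mod_cast (by omega : m * q ≤ N)
    have ht := φ.tail_nonneg (t := 3 / 2 * (m * q)) (by
      have : (1 : ℝ) ≤ q := by exact_mod_cast hq
      nlinarith)
    have k1 : a (m * q) ≤ N * b m := by
      have : (q : ℝ) * a m + 9 / 2 * C * (m * q) * (φ.tail m - φ.tail (3 / 2 * (m * q)))
          ≤ (m * q) * b m := by
        have e : (m * q : ℝ) * b m = q * a m + 9 / 2 * C * (m * q) * φ.tail m := by
          simp only [hb]; field_simp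
        rw [e]
        have : 0 ≤ 9 / 2 * C * (m * q) * φ.tail (3 / 2 * (m * q)) :=
          mul_nonneg (by positivity) ht
        linarith
      exact key.trans (this.trans (mul_le_mul_of_nonneg_right hqN (b0 m hm)))
    rw [div_le_iff₀ hN0]
    have k2 : (M / N + C * (φ.toFun N / N)) * N = M + C * φ.toFun N := by
      field_simp
    have k3 := mul_le_mul_of_nonneg_right hN.le hN0.le
    rw [k2] at k3
    linarith
  refine ⟨L, Metric.tendsto_nhds.2 fun ε hε => ?_⟩
  obtain ⟨_, ⟨m, hm, rfl⟩, hmL⟩ := exists_lt_of_csInf_lt (s := b '' Set.Ici 1)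
    ⟨_, 1, le_refl 1, rfl⟩ (show sInf (b '' Set.Ici 1) < L + ε / 2 by linarith)
  have lim2 : Tendsto (fun N : ℕ => 9 / 2 * C * φ.tail N) atTop (𝓝 0) := by
    simpa using φ.tail_tendsto.const_mul (9 / 2 * C)
  filter_upwards [upper m hm (ε / 4) (by linarith), lim2.eventually (gt_mem_nhds hε),
    eventually_ge_atTop 1] with N h1 h2 h3
  have h4 := hLb N h3
  simp only [hb] at h4
  rw [Real.dist_eq, abs_lt]
  constructor <;> linarith

end AdmissibleFunction

section TropicalDiagrams

variable {G : Type*} [PartialOrder G] [Fintype G] [OrderBot G]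

/-- A `φ`-quasi-linear sequence of `G`-diagrams. -/
structure QuasiLinear (G : Type*) [PartialOrder G] [Fintype G] [OrderBot G]
    (φ : AdmissibleFunction) where
  seq : ℕ → Diagram G
  quasi : ∃ C : ℝ, ∀ n m : ℕ, 1 ≤ n + m →
    aikd (seq (n + m)) ((seq n).tensor (seq m)) ≤ C * φ.toFun ((n + m : ℕ) : ℝ)

namespace QuasiLinear

variable {φ : AdmissibleFunction}

/-- The asymptotic entropy distance between quasi-linear sequences. -/
noncomputable def asympDist (X Y : QuasiLinear G φ) : ℝ :=
  limUnder atTop fun n : ℕ => aikd (X.seq n) (Y.seq n) / n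

lemma quasi' (X : QuasiLinear G φ) : ∃ C : ℝ, 0 ≤ C ∧ ∀ n m : ℕ, 1 ≤ n + m →
    aikd (X.seq (n + m)) ((X.seq n).tensor (X.seq m)) ≤ C * φ.toFun ((n + m : ℕ) : ℝ) := by
  obtain ⟨C, hC⟩ := X.quasi
  refine ⟨|C|, abs_nonneg _, fun n m h => (hC n m h).trans ?_⟩
  exact mul_le_mul_of_nonneg_right (le_abs_self _) (φ.pos _ (by exact_mod_cast h)).le

/-- The limit in the definition of `asympDist` exists. -/
lemma tendsto_asympDist (X Y : QuasiLinear G φ) :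
    Tendsto (fun n : ℕ => aikd (X.seq n) (Y.seq n) / n) atTop (𝓝 (X.asympDist Y)) := by
  obtain ⟨C, hC0, hC⟩ := X.quasi'
  obtain ⟨D, hD0, hD⟩ := Y.quasi'
  refine tendsto_nhds_limUnder (φ.exists_tendsto (add_nonneg hC0 hD0)
    (fun n => aikd_nonneg _ _) fun n m hn hm => ?_)
  have h1 := aikd_triangle (X.seq (n + m)) ((X.seq n).tensor (X.seq m)) (Y.seq (n + m))
  have h2 := aikd_triangle ((X.seq n).tensor (X.seq m)) ((Y.seq n).tensor (Y.seq m)) (Y.seq (n + m))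
  have h3 := aikd_tensor_le (X.seq n) (X.seq m) (Y.seq n) (Y.seq m)
  have h4 := hC n m (by omega)
  have h5 := hD n m (by omega)
  rw [aikd_symm] at h5
  linarith

noncomputable instance : PseudoMetricSpace (QuasiLinear G φ) where
  dist := asympDist
  dist_self X := by
    refine tendsto_nhds_unique (tendsto_asympDist X X) ?_
    simp [aikd_self]
  dist_comm X Y := by
    unfold asympDist
    simp only [aikd_symm]
  dist_triangle X Y Z := by
    refine le_of_tendsto_of_tendsto' (tendsto_asympDist X Z)
      ((tendsto_asympDist X Y).add (tendsto_asympDist Y Z)) fun n => ?_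
    rw [← add_div]
    exact div_le_div_of_nonneg_right (aikd_triangle _ _ _) n.cast_nonneg

lemma dist_def (X Y : QuasiLinear G φ) : dist X Y = X.asympDist Y := rfl

/-- A sufficient condition for asymptotic equivalence. -/
lemma dist_eq_zero_of_le {X Y : QuasiLinear G φ} (C D : ℝ) (K : ℝ) (hK : 1 ≤ K) (hC : 0 ≤ C)
    (h : ∀ n : ℕ, 1 ≤ n → aikd (X.seq n) (Y.seq n) ≤ C * φ.toFun (K * n) + D) :
    dist X Y = 0 := by
  refine tendsto_nhds_unique (tendsto_asympDist X Y) ?_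
  obtain ⟨E, hE0, hE⟩ := φ.exists_scale K hK
  have l1 := (φ.div_tendsto.const_mul (C * E)).add (tendsto_const_div_atTop_nhds_zero_nat D)
  rw [mul_zero, add_zero] at l1
  refine tendsto_of_tendsto_of_tendsto_of_le_of_le' tendsto_const_nhds l1
    (Eventually.of_forall fun n => div_nonneg (aikd_nonneg _ _) n.cast_nonneg) ?_
  filter_upwards [eventually_ge_atTop 1] with n hn
  have hn' : (1 : ℝ) ≤ n := by exact_mod_cast hn
  have h1 := h n hn
  have h2 := mul_le_mul_of_nonneg_left (hE n hn') hC
  rw [div_le_iff₀ (by linarith)]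
  have e : (C * E * (φ.toFun n / n) + D / n) * n = C * (E * φ.toFun n) + D := by
    field_simp
  rw [e]
  linarith

/-- The termwise tensor product of two sequences. -/
noncomputable def tensor (X Y : QuasiLinear G φ) : QuasiLinear G φ where
  seq n := (X.seq n).tensor (Y.seq n)
  quasi := by
    obtain ⟨C, hC⟩ := X.quasi
    obtain ⟨D, hD⟩ := Y.quasi
    refine ⟨C + D, fun n m h => ?_⟩
    have h1 := aikd_triangle ((X.seq (n + m)).tensor (Y.seq (n + m)))
      (((X.seq n).tensor (X.seq m)).tensor ((Y.seq n).tensor (Y.seq m)))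
      (((X.seq n).tensor (Y.seq n)).tensor ((X.seq m).tensor (Y.seq m)))
    have h2 := aikd_tensor_le (X.seq (n + m)) (Y.seq (n + m))
      ((X.seq n).tensor (X.seq m)) ((Y.seq n).tensor (Y.seq m))
    have h3 := aikd_eq_zero (ikd_interchange (X.seq n) (X.seq m) (Y.seq n) (Y.seq m))
    have := hC n m h
    have := hD n m h
    linarith

/-- The linear sequence `n ↦ X ^ n` of a diagram. -/
noncomputable def linear (φ : AdmissibleFunction) (X : Diagram G) : QuasiLinear G φ where
  seq n := X.pow n
  quasi := ⟨0, fun n m _ => by rw [aikd_eq_zero (ikd_pow_add X n m), zero_mul]⟩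

/-- Adding a bounded amount to the index changes a quasi-linear sequence only a little. -/
lemma shift_le (X : QuasiLinear G φ) (B : ℕ) :
    ∃ C D : ℝ, 0 ≤ C ∧ 0 ≤ D ∧ ∀ (k r : ℕ) (t : ℝ), r ≤ B → 1 ≤ t → ((k + r : ℕ) : ℝ) ≤ t →
      aikd (X.seq (k + r)) (X.seq k) ≤ C * φ.toFun t + D := by
  obtain ⟨C, hC0, hC⟩ := X.quasi'
  refine ⟨C, ∑ r ∈ Finset.range (B + 1), aikd (X.seq r) (Diagram.trivial G), hC0,
    Finset.sum_nonneg fun _ _ => aikd_nonneg _ _, fun k r t hr ht hkr => ?_⟩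
  have h4 : aikd (X.seq r) (Diagram.trivial G)
      ≤ ∑ r ∈ Finset.range (B + 1), aikd (X.seq r) (Diagram.trivial G) :=
    Finset.single_le_sum (f := fun r => aikd (X.seq r) (Diagram.trivial G))
      (fun _ _ => aikd_nonneg _ _) (Finset.mem_range.2 (by omega))
  rcases Nat.eq_zero_or_pos (k + r) with h0 | h0
  · obtain ⟨rfl, rfl⟩ : k = 0 ∧ r = 0 := by omega
    have h5 := aikd_nonneg (X.seq 0) (Diagram.trivial G)
    have h6 := mul_nonneg hC0 (φ.pos t ht).le
    rw [add_zero, aikd_self]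
    linarith
  · have h1 := aikd_triangle (X.seq (k + r)) ((X.seq k).tensor (X.seq r)) (X.seq k)
    have h2 := aikd_triangle ((X.seq k).tensor (X.seq r)) ((X.seq k).tensor (Diagram.trivial G))
      (X.seq k)
    have h3 := aikd_tensor_le (X.seq k) (X.seq r) (X.seq k) (Diagram.trivial G)
    rw [aikd_self] at h3
    rw [aikd_eq_zero (ikd_tensor_trivial _)] at h2
    have h5 := hC k r h0
    have h1' : (1 : ℝ) ≤ ((k + r : ℕ) : ℝ) := by exact_mod_cast h0
    have h6 := mul_le_mul_of_nonneg_left (φ.mono h1' ht hkr) hC0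
    linarith

/-- Splitting the index up to a bounded amount. -/
lemma split_le (X : QuasiLinear G φ) (B : ℕ) :
    ∃ C D : ℝ, 0 ≤ C ∧ 0 ≤ D ∧ ∀ (j k r : ℕ) (t : ℝ), r ≤ B → 1 ≤ t → ((j + k + r : ℕ) : ℝ) ≤ t →
      aikd (X.seq (j + k + r)) ((X.seq j).tensor (X.seq k)) ≤ C * φ.toFun t + D := by
  obtain ⟨C, hC0, hC⟩ := X.quasi'
  obtain ⟨C', D', hC0', hD0', h'⟩ := X.shift_le B
  refine ⟨C' + C, D' + aikd (X.seq 0) ((X.seq 0).tensor (X.seq 0)), by positivity,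
    add_nonneg hD0' (aikd_nonneg _ _), fun j k r t hr ht hkr => ?_⟩
  have h1 := aikd_triangle (X.seq (j + k + r)) (X.seq (j + k)) ((X.seq j).tensor (X.seq k))
  have h2 := h' (j + k) r t hr ht hkr
  have h3 : aikd (X.seq (j + k)) ((X.seq j).tensor (X.seq k))
      ≤ C * φ.toFun t + aikd (X.seq 0) ((X.seq 0).tensor (X.seq 0)) := by
    rcases Nat.eq_zero_or_pos (j + k) with h0 | h0
    · obtain ⟨rfl, rfl⟩ : j = 0 ∧ k = 0 := by omega
      have h6 := mul_nonneg hC0 (φ.pos t ht).le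
      rw [add_zero]
      linarith
    · have h1' : (1 : ℝ) ≤ ((j + k : ℕ) : ℝ) := by exact_mod_cast h0
      have hle : ((j + k : ℕ) : ℝ) ≤ t := by
        refine le_trans ?_ hkr
        exact_mod_cast Nat.le_add_right _ _
      have h6 := mul_le_mul_of_nonneg_left (φ.mono h1' ht hle) hC0
      have h7 := aikd_nonneg (X.seq 0) ((X.seq 0).tensor (X.seq 0))
      have h8 := hC j k h0
      linarith
  linarith

/-- The index `⌊(a + b) n⌋` splits as `⌊a n⌋ + ⌊b n⌋`, up to one. -/
lemma floor_split (x y : ℝ≥0) : ∃ r ≤ 1, ⌊x + y⌋₊ = ⌊x⌋₊ + ⌊y⌋₊ + r := by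
  have h1 : ⌊x⌋₊ + ⌊y⌋₊ ≤ ⌊x + y⌋₊ := Nat.le_floor (by
    push_cast
    exact add_le_add (Nat.floor_le zero_le) (Nat.floor_le zero_le))
  have h2 : ⌊x + y⌋₊ < ⌊x⌋₊ + ⌊y⌋₊ + 2 := (Nat.floor_lt zero_le).2 (by
    push_cast
    calc x + y < (⌊x⌋₊ + 1) + (⌊y⌋₊ + 1) := add_lt_add (Nat.lt_floor_add_one x) (Nat.lt_floor_add_one y)
      _ = _ := by ring)
  exact ⟨⌊x + y⌋₊ - (⌊x⌋₊ + ⌊y⌋₊), by omega, by omega⟩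

lemma floor_le_mul (r : ℝ≥0) (n : ℕ) : ((⌊r * n⌋₊ : ℕ) : ℝ) ≤ (r + 1) * n := by
  have : ((⌊r * n⌋₊ : ℕ) : ℝ≥0) ≤ r * n := Nat.floor_le zero_le
  have h2 : ((⌊r * n⌋₊ : ℕ) : ℝ) ≤ r * n := by exact_mod_cast this
  have h3 : (0 : ℝ) ≤ n := n.cast_nonneg
  linarith

/-- The action of nonnegative reals: `n ↦ X ⌊r n⌋`. -/
noncomputable def scale (r : ℝ≥0) (X : QuasiLinear G φ) : QuasiLinear G φ where
  seq n := X.seq ⌊r * n⌋₊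
  quasi := by
    obtain ⟨C, D, hC, hD, h⟩ := X.split_le 1
    obtain ⟨E, hE0, hE⟩ := φ.exists_scale (r + 1) (by simp)
    refine ⟨C * E + D / φ.toFun 1, fun n m hnm => ?_⟩
    obtain ⟨s, hs, e⟩ := floor_split (r * n) (r * m)
    rw [← mul_add, ← Nat.cast_add] at e
    have hnm' : (1 : ℝ) ≤ ((n + m : ℕ) : ℝ) := by exact_mod_cast hnm
    have h1 := h ⌊r * n⌋₊ ⌊r * m⌋₊ s ((r + 1) * ((n + m : ℕ) : ℝ)) hs (by
        have : (0 : ℝ) ≤ r := r.2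
        nlinarith) (by rw [← e]; exact floor_le_mul r (n + m))
    rw [← e] at h1
    have h2 := mul_le_mul_of_nonneg_left (hE _ hnm') hC
    have h3 : D ≤ D / φ.toFun 1 * φ.toFun ((n + m : ℕ) : ℝ) := by
      have p := φ.pos 1 le_rfl
      have q := φ.mono (Set.mem_Ici.2 le_rfl) hnm' hnm'
      rw [div_mul_eq_mul_div, le_div_iff₀ p]
      exact mul_le_mul_of_nonneg_left q hD
    linarith

lemma dist_scale (r : ℝ≥0) (X Y : QuasiLinear G φ) :
    dist (X.scale r) (Y.scale r) = r * dist X Y := by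
  refine tendsto_nhds_unique (tendsto_asympDist (X.scale r) (Y.scale r)) ?_
  have hfl : Tendsto (fun n : ℕ => ((⌊(r : ℝ) * n⌋₊ : ℕ) : ℝ) / n) atTop (𝓝 r) :=
    (tendsto_nat_floor_mul_div_atTop r.2).comp tendsto_natCast_atTop_atTop
  have efl : ∀ n : ℕ, ⌊r * (n : ℝ≥0)⌋₊ = ⌊(r : ℝ) * n⌋₊ := fun n => by
    refine (Nat.floor_eq_iff zero_le).2 ⟨?_, ?_⟩
    · rw [← NNReal.coe_le_coe]
      push_cast
      exact Nat.floor_le (by positivity)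
    · rw [← NNReal.coe_lt_coe]
      push_cast
      exact Nat.lt_floor_add_one _
  rcases eq_or_lt_of_le (zero_le (a := r)) with h0 | h0
  · subst h0
    simp only [scale, zero_mul, Nat.floor_zero, NNReal.coe_zero]
    exact tendsto_const_div_atTop_nhds_zero_nat _
  · have hinf : Tendsto (fun n : ℕ => ⌊(r : ℝ) * n⌋₊) atTop atTop :=
      tendsto_nat_floor_atTop.comp
        (tendsto_natCast_atTop_atTop.const_mul_atTop (by exact_mod_cast h0))
    have h := hfl.mul ((tendsto_asympDist X Y).comp hinf)
    refine h.congr' ?_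
    filter_upwards [hinf.eventually_gt_atTop 0] with n hn
    have hn' : ((⌊(r : ℝ) * n⌋₊ : ℕ) : ℝ) ≠ 0 := by exact_mod_cast hn.ne'
    simp only [scale, efl, Function.comp]
    field_simp

lemma dist_tensor_le (X Y X' Y' : QuasiLinear G φ) :
    dist (X.tensor Y) (X'.tensor Y') ≤ dist X X' + dist Y Y' := by
  refine le_of_tendsto_of_tendsto' (tendsto_asympDist (X.tensor Y) (X'.tensor Y'))
    ((tendsto_asympDist X X').add (tendsto_asympDist Y Y')) fun n => ?_
  rw [← add_div]
  exact div_le_div_of_nonneg_right (aikd_tensor_le _ _ _ _) n.cast_nonneg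

lemma dist_eq_zero_of_forall {X Y : QuasiLinear G φ} (h : ∀ n, ikd (X.seq n) (Y.seq n) = 0) :
    dist X Y = 0 := by
  refine tendsto_nhds_unique (tendsto_asympDist X Y) ?_
  simp [aikd_eq_zero (h _)]

lemma dist_scale_add (a b : ℝ≥0) (X : QuasiLinear G φ) :
    dist (X.scale (a + b)) ((X.scale a).tensor (X.scale b)) = 0 := by
  obtain ⟨C, D, hC, hD, h⟩ := X.split_le 1
  refine dist_eq_zero_of_le C D ((a + b : ℝ≥0) + 1) (by
    have : (0 : ℝ) ≤ (a + b : ℝ≥0) := (a + b).2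
    linarith) hC fun n hn => ?_
  obtain ⟨s, hs, e⟩ := floor_split (a * n) (b * n)
  rw [← add_mul] at e
  have hn' : (1 : ℝ) ≤ n := by exact_mod_cast hn
  have h1 := h ⌊a * n⌋₊ ⌊b * n⌋₊ s (((a + b : ℝ≥0) + 1) * n) hs (by
    have : (0 : ℝ) ≤ (a + b : ℝ≥0) := (a + b).2
    nlinarith) (by rw [← e]; exact floor_le_mul (a + b) n)
  rw [← e] at h1
  exact h1

lemma dist_scale_mul (a b : ℝ≥0) (X : QuasiLinear G φ) :
    dist (X.scale (a * b)) ((X.scale a).scale b) = 0 := by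
  obtain ⟨C, D, hC, hD, h⟩ := X.shift_le (⌊a⌋₊ + 1)
  refine dist_eq_zero_of_le C D ((a * b : ℝ≥0) + 1) (by
    have : (0 : ℝ) ≤ (a * b : ℝ≥0) := (a * b).2
    linarith) hC fun n hn => ?_
  have hle : ⌊a * ⌊b * n⌋₊⌋₊ ≤ ⌊a * b * n⌋₊ := by
    refine Nat.floor_mono ?_
    rw [mul_assoc]
    exact mul_le_mul_of_nonneg_left (Nat.floor_le zero_le) zero_le
  have hlt : ⌊a * b * n⌋₊ < ⌊a * ⌊b * n⌋₊⌋₊ + (⌊a⌋₊ + 1) + 1 := by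
    refine (Nat.floor_lt zero_le).2 ?_
    push_cast
    calc a * b * n = a * (b * n) := mul_assoc _ _ _
      _ ≤ a * (⌊b * n⌋₊ + 1) := mul_le_mul_of_nonneg_left (Nat.lt_floor_add_one _).le zero_le
      _ = a * ⌊b * n⌋₊ + a := by ring
      _ < (⌊a * ⌊b * n⌋₊⌋₊ + 1) + (⌊a⌋₊ + 1) :=
        add_lt_add (Nat.lt_floor_add_one _) (Nat.lt_floor_add_one _)
      _ = _ := by ring
  have hn' : (1 : ℝ) ≤ n := by exact_mod_cast hn
  have e : ⌊a * ⌊b * n⌋₊⌋₊ + (⌊a * b * n⌋₊ - ⌊a * ⌊b * n⌋₊⌋₊) = ⌊a * b * n⌋₊ := by omega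
  have h1 := h ⌊a * ⌊b * n⌋₊⌋₊ (⌊a * b * n⌋₊ - ⌊a * ⌊b * n⌋₊⌋₊) (((a * b : ℝ≥0) + 1) * n)
    (by omega) (by
      have : (0 : ℝ) ≤ (a * b : ℝ≥0) := (a * b).2
      nlinarith) (by rw [e]; exact floor_le_mul (a * b) n)
  rw [e] at h1
  exact h1

end QuasiLinear

/-- The space `prob[G]` of tropical `G`-diagrams: classes of `φ`-quasi-linear sequences at
asymptotic entropy distance zero, with the metric given by the asymptotic entropy distance. -/
def TropicalDiagram (G : Type*) [PartialOrder G] [Fintype G] [OrderBot G]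
    (φ : AdmissibleFunction) : Type _ :=
  SeparationQuotient (QuasiLinear G φ)

namespace TropicalDiagram

variable {φ : AdmissibleFunction}

noncomputable instance : MetricSpace (TropicalDiagram G φ) :=
  inferInstanceAs (MetricSpace (SeparationQuotient (QuasiLinear G φ)))

/-- The class of a quasi-linear sequence. -/
noncomputable def mk (X : QuasiLinear G φ) : TropicalDiagram G φ := SeparationQuotient.mk X

lemma dist_mk (X Y : QuasiLinear G φ) : dist (mk X) (mk Y) = X.asympDist Y :=
  SeparationQuotient.dist_mk X Y

lemma mk_surjective : Function.Surjective (mk : QuasiLinear G φ → TropicalDiagram G φ) :=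
  SeparationQuotient.surjective_mk

lemma mk_eq {X Y : QuasiLinear G φ} (h : dist X Y = 0) : mk X = mk Y :=
  SeparationQuotient.mk_eq_mk.2 (Metric.inseparable_iff.2 h)

lemma inseparable_iff {X Y : QuasiLinear G φ} : Inseparable X Y ↔ dist X Y = 0 :=
  Metric.inseparable_iff

/-- The sum of classes is the class of the termwise tensor product. -/
noncomputable instance : Add (TropicalDiagram G φ) where
  add := Quotient.map₂ QuasiLinear.tensor fun X X' h Y Y' h' => by
    have h1 : dist X X' = 0 := inseparable_iff.1 h
    have h2 : dist Y Y' = 0 := inseparable_iff.1 h'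
    refine inseparable_iff.2 (le_antisymm ?_ dist_nonneg)
    exact (QuasiLinear.dist_tensor_le X Y X' Y').trans (by rw [h1, h2, add_zero])

lemma mk_add (X Y : QuasiLinear G φ) : mk X + mk Y = mk (X.tensor Y) := rfl

noncomputable instance : Zero (TropicalDiagram G φ) where
  zero := mk (QuasiLinear.linear φ (Diagram.trivial G))

lemma zero_def : (0 : TropicalDiagram G φ) = mk (QuasiLinear.linear φ (Diagram.trivial G)) := rfl

/-- The action of nonnegative reals is induced by `(r X)(n) = X ⌊r n⌋`. -/
noncomputable instance : SMul ℝ≥0 (TropicalDiagram G φ) where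
  smul r := Quotient.map (QuasiLinear.scale r) fun X X' h => by
    have h1 : dist X X' = 0 := inseparable_iff.1 h
    refine inseparable_iff.2 ?_
    rw [QuasiLinear.dist_scale, h1, mul_zero]

lemma smul_mk (r : ℝ≥0) (X : QuasiLinear G φ) : r • mk X = mk (X.scale r) := rfl

lemma ikd_trivial_pow (n : ℕ) : ikd ((Diagram.trivial G).pow n) (Diagram.trivial G) = 0 := by
  induction n with
  | zero => exact ikd_self _
  | succ n ih => exact ikd_zero_trans (ikd_zero_tensor ih (ikd_self _)) (ikd_tensor_trivial _)

lemma add_comm' (a b : TropicalDiagram G φ) : a + b = b + a := by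
  obtain ⟨X, rfl⟩ := mk_surjective a
  obtain ⟨Y, rfl⟩ := mk_surjective b
  exact mk_eq (QuasiLinear.dist_eq_zero_of_forall fun n => ikd_comm _ _)

lemma add_zero' (a : TropicalDiagram G φ) : a + 0 = a := by
  obtain ⟨X, rfl⟩ := mk_surjective a
  exact mk_eq (QuasiLinear.dist_eq_zero_of_forall fun n =>
    ikd_zero_trans (ikd_zero_tensor (ikd_self _) (ikd_trivial_pow n)) (ikd_tensor_trivial _))

noncomputable instance : AddCommMonoid (TropicalDiagram G φ) where
  add_assoc a b c := by
    obtain ⟨X, rfl⟩ := mk_surjective a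
    obtain ⟨Y, rfl⟩ := mk_surjective b
    obtain ⟨Z, rfl⟩ := mk_surjective c
    exact mk_eq (QuasiLinear.dist_eq_zero_of_forall fun n => ikd_assoc _ _ _)
  zero_add a := (add_comm' 0 a).trans (add_zero' a)
  add_zero := add_zero'
  add_comm := add_comm'
  nsmul := nsmulRec

noncomputable instance : Module ℝ≥0 (TropicalDiagram G φ) where
  one_smul a := by
    obtain ⟨X, rfl⟩ := mk_surjective a
    exact mk_eq (QuasiLinear.dist_eq_zero_of_forall fun n => by
      simp [QuasiLinear.scale, ikd_self])
  mul_smul r s a := by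
    obtain ⟨X, rfl⟩ := mk_surjective a
    rw [mul_comm]
    exact mk_eq (QuasiLinear.dist_scale_mul s r X)
  smul_zero r := mk_eq (QuasiLinear.dist_eq_zero_of_forall fun n =>
    ikd_zero_trans (ikd_trivial_pow _) (by rw [ikd_symm]; exact ikd_trivial_pow n))
  smul_add r a b := by
    obtain ⟨X, rfl⟩ := mk_surjective a
    obtain ⟨Y, rfl⟩ := mk_surjective b
    rfl
  add_smul r s a := by
    obtain ⟨X, rfl⟩ := mk_surjective a
    exact mk_eq (QuasiLinear.dist_scale_add r s X)
  zero_smul a := by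
    obtain ⟨X, rfl⟩ := mk_surjective a
    refine mk_eq (tendsto_nhds_unique (QuasiLinear.tendsto_asympDist _ _) ?_)
    have e : ∀ n : ℕ, aikd ((X.scale 0).seq n)
        ((QuasiLinear.linear φ (Diagram.trivial G)).seq n) ≤ aikd (X.seq 0) (Diagram.trivial G) := by
      intro n
      have h1 := aikd_triangle (X.seq 0) (Diagram.trivial G) ((Diagram.trivial G).pow n)
      have h2 := aikd_eq_zero (ikd_trivial_pow (G := G) n)
      rw [aikd_symm] at h2
      simp only [QuasiLinear.scale, zero_mul, Nat.floor_zero, QuasiLinear.linear]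
      linarith
    refine tendsto_of_tendsto_of_tendsto_of_le_of_le tendsto_const_nhds
      (tendsto_const_div_atTop_nhds_zero_nat (aikd (X.seq 0) (Diagram.trivial G)))
      (fun n => div_nonneg (aikd_nonneg _ _) n.cast_nonneg) fun n => ?_
    exact div_le_div_of_nonneg_right (e n) n.cast_nonneg

end TropicalDiagram

/-- The tropical diagram `[X | X_ι] = ∫ (X | u) dp(u)`: the convex combination, over the atoms `u`
of `X_ι`, of the classes of the linear sequences `n ↦ (X | u) ^ n`. -/
noncomputable def Diagram.tropicalCond (φ : AdmissibleFunction) (X : Diagram G) (ι : G) :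
    TropicalDiagram G φ :=
  ∑ u : (X.law ι).weights.support, ((X.law ι).weights u).toNNReal •
    TropicalDiagram.mk (QuasiLinear.linear φ (X.cond ι u))

end TropicalDiagrams

end TropProb

/-! Everything rests on one estimate for a fan `X ← Z → Y`, proved in `dist_tropicalCond_le_kd`: the
tropical diagrams obtained by conditioning `X` on `U = X_ι` and `Y` on `V = Y_ι` are at distance at
most `(2|G| + 1) * kd`. Both `U` and `V` are functions of the initial space of `Z`, so one passes
from `[X|U]` to the average of `Z|u`, then to the average of `Z|(u,v)`, and back down on the other
side. Replacing `X|u` by `Z|u` costs on average at most the entropy defect of `Z → X`, since `H(Z_i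
| X_i, U) ≤ H(Z_i | X_i)`. The two replacements together cost `kd`. Conditioning further on `V`
costs `2|G| H(V|U)`, and `H(V|U) ≤ Ent Z_ι - Ent X_ι` because `(U, V)` is a function of `Z_ι`. The
two defects at `ι` add up to at most `kd`, which gives the term `2|G|`.

The cost of further conditioning comes from mixtures. A mixture of diagrams that remembers its index
at every object has a large tensor power in which, by the weak law of large numbers, the components
occur in nearly the expected proportions. Forgetting the index costs its entropy once per object, so
the mixture is within `|G| H(index)` of the convex combination of its components
(`dist_ofDiagram_mix_le`). The mixture of the conditioned diagrams reduces to the original diagram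
at a similar cost, by concavity of entropy.

Conditioning turns tensor products into sums. Applied to large powers, the estimate therefore holds
with the asymptotic distance in place of the intrinsic one, and `n ↦ [X(n)|U(n)]` is quasi-linear up
to `φ`. A quasi-linear sequence of tropical diagrams converges after division by `n`: every tropical
diagram lies at uniformly bounded distance from the class of a single diagram
(`exists_dist_ofDiagram_le`), so the sequence may be replaced by a quasi-linear sequence of
diagrams, whose own class is the limit (`exists_tendsto_inv_smul`). Lipschitz continuity,
independence of the representative and linearity then pass to the limit. -/

namespace TropProb

/-! ### Expectation, entropy and conditioning of finite distributions. -/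

section Distributions

variable {S T C : Type}

lemma sum_weights (p : Distribution S) : ∑ x ∈ p.weights.support, p.weights x = 1 := p.total

lemma expect_sub (p : Distribution S) (f g : S → ℝ) :
    expect p (fun x => f x - g x) = expect p f - expect p g := by
  simp [expect_eq, mul_sub, Finset.sum_sub_distrib]

lemma expect_const_mul (p : Distribution S) (c : ℝ) (f : S → ℝ) :
    expect p (fun x => c * f x) = c * expect p f := by
  simp only [expect_eq, Finset.mul_sum]
  exact Finset.sum_congr rfl fun _ _ => by ring

lemma expect_sum {ι : Type*} (p : Distribution S) (A : Finset ι) (f : ι → S → ℝ) :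
    expect p (fun x => ∑ i ∈ A, f i x) = ∑ i ∈ A, expect p (f i) := by
  simp only [expect_eq, Finset.mul_sum]
  exact Finset.sum_comm

lemma entropy_nonneg (p : Distribution S) : 0 ≤ entropy p := by
  refine Finset.sum_nonneg fun x hx => Real.negMulLog_nonneg (p.nonneg x) ?_
  rw [← sum_weights p]
  exact Finset.single_le_sum (f := p.weights) (fun i _ => p.nonneg i) hx

/-- The inequality `1 - 1/w ≤ log w`, summed over the support. It serves to bound the entropy of a
two-point distribution by `1`. -/
lemma entropy_le_card_sub_one (p : Distribution S) :
    entropy p ≤ p.weights.support.card - 1 := by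
  have h : ∀ x ∈ p.weights.support, Real.negMulLog (p.weights x) ≤ 1 - p.weights x := fun x hx => by
    have h0 := pos_of_mem hx
    have h1 := Real.one_sub_inv_le_log_of_pos h0
    have h2 := mul_le_mul_of_nonneg_left h1 h0.le
    rw [mul_sub, mul_inv_cancel₀ h0.ne'] at h2
    unfold Real.negMulLog
    linarith
  refine (Finset.sum_le_sum h).trans (le_of_eq ?_)
  rw [Finset.sum_sub_distrib, sum_weights]
  simp

/-- Entropy cannot increase under `f`, nor under a left inverse of `f`. -/
lemma entropy_map_of_injective (p : Distribution S) {f : S → T} (hf : Function.Injective f) :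
    entropy (p.map f) = entropy p := by
  refine le_antisymm (entropy_map_le p f) ?_
  obtain ⟨x, -⟩ := p.support_weights_nonempty
  have : Nonempty S := ⟨x⟩
  have h := entropy_map_le (p.map f) (Function.invFun f)
  have e : (fun x => Function.invFun f (f x)) = id := funext (Function.leftInverse_invFun hf)
  rwa [Convexity.StdSimplex.map_map, e, Convexity.StdSimplex.map_id] at h

/-! ### Expectations with values in a module over the nonnegative reals -/

/-- The expectation of a function with values in a module over the nonnegative reals. -/
noncomputable def expectVec {M : Type*} [AddCommMonoid M] [Module ℝ≥0 M] (p : Distribution S)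
    (f : S → M) : M :=
  ∑ x ∈ p.weights.support, (p.weights x).toNNReal • f x

section ExpectVec

variable {M : Type*} [AddCommMonoid M] [Module ℝ≥0 M]

lemma expectVec_congr (p : Distribution S) {f g : S → M}
    (h : ∀ x ∈ p.weights.support, f x = g x) : expectVec p f = expectVec p g :=
  Finset.sum_congr rfl fun x hx => by rw [h x hx]

/-- The sum over the support of `p` is grouped by the fibres of `g`. -/
lemma expectVec_map (p : Distribution S) (g : S → T) (f : T → M) :
    expectVec (p.map g) f = expectVec p (fun x => f (g x)) := by
  classical
  unfold expectVec
  have h1 : ∀ t ∈ (p.map g).weights.support, ((p.map g).weights t).toNNReal • f t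
      = ∑ x ∈ p.weights.support with g x = t, (p.weights x).toNNReal • f (g x) := by
    intro t _
    have : ∀ x ∈ {x ∈ p.weights.support | g x = t},
        (p.weights x).toNNReal • f (g x) = (p.weights x).toNNReal • f t := fun x hx => by
      rw [(Finset.mem_filter.1 hx).2]
    rw [Finset.sum_congr rfl this, ← Finset.sum_smul, ← Real.toNNReal_sum_of_nonneg
      (fun x _ => p.nonneg x), map_weights_apply, expect_eq, Finset.sum_filter]
    simp
  rw [Finset.sum_congr rfl h1]
  exact Finset.sum_fiberwise_of_maps_to (fun x hx => mem_support_map g hx) _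

lemma expectVec_add (p : Distribution S) (f g : S → M) :
    expectVec p (fun x => f x + g x) = expectVec p f + expectVec p g := by
  simp [expectVec, Finset.sum_add_distrib]

lemma expectVec_const (p : Distribution S) (c : M) : expectVec p (fun _ => c) = c := by
  unfold expectVec
  rw [← Finset.sum_smul, ← Real.toNNReal_sum_of_nonneg (fun x _ => p.nonneg x), sum_weights]
  simp

end ExpectVec

/-! ### Joint distributions and conditioning -/

/-- The joint distribution of an index with law `p` and a point with conditional law `μ s`. -/
noncomputable def sigmaDist {T : S → Type} (p : Distribution S) (μ : ∀ s, Distribution (T s)) :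
    Distribution (Σ s, T s) where
  weights := Finsupp.onFinset (p.weights.support.sigma fun s => (μ s).weights.support)
    (fun x => p.weights x.1 * (μ x.1).weights x.2) (fun x hx => by
      simpa [Finset.mem_sigma] using hx)
  nonneg := fun x => mul_nonneg (p.nonneg x.1) ((μ x.1).nonneg x.2)
  total := by
    rw [Finsupp.onFinset_sum _ (fun _ => rfl), Finset.sum_sigma]
    rw [← sum_weights p]
    refine Finset.sum_congr rfl fun s _ => ?_
    simp only
    rw [← Finset.mul_sum, sum_weights (μ s), mul_one]

section SigmaDist

variable {T : S → Type} (p : Distribution S) (μ : ∀ s, Distribution (T s))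

lemma sigmaDist_weights (x : Σ s, T s) :
    (sigmaDist p μ).weights x = p.weights x.1 * (μ x.1).weights x.2 := rfl

lemma mem_support_sigma {x : Σ s, T s} : x ∈ (sigmaDist p μ).weights.support ↔
    x.1 ∈ p.weights.support ∧ x.2 ∈ (μ x.1).weights.support := by
  simp [sigmaDist_weights, Finsupp.mem_support_iff]

lemma support_sigmaDist : (sigmaDist p μ).weights.support
    = p.weights.support.sigma fun s => (μ s).weights.support := by
  ext x
  rw [mem_support_sigma, Finset.mem_sigma]

lemma expect_sigma (F : (Σ s, T s) → ℝ) :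
    expect (sigmaDist p μ) F = expect p fun s => expect (μ s) fun t => F ⟨s, t⟩ := by
  simp only [expect_eq, support_sigmaDist, Finset.sum_sigma, Finset.mul_sum, sigmaDist_weights,
    mul_assoc]

lemma expectVec_sigma {M : Type*} [AddCommMonoid M] [Module ℝ≥0 M] (F : (Σ s, T s) → M) :
    expectVec (sigmaDist p μ) F = expectVec p fun s => expectVec (μ s) fun t => F ⟨s, t⟩ := by
  simp only [expectVec, support_sigmaDist, Finset.sum_sigma, Finset.smul_sum, sigmaDist_weights]
  refine Finset.sum_congr rfl fun s _ => Finset.sum_congr rfl fun t _ => ?_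
  rw [Real.toNNReal_mul (p.nonneg s), mul_smul]

lemma entropy_sigma :
    entropy (sigmaDist p μ) = entropy p + expect p fun s => entropy (μ s) := by
  simp only [entropy_eq, expect_sigma]
  rw [← expect_add]
  refine expect_congr p fun s hs => ?_
  rw [← expect_const (μ s) (- Real.log (p.weights s)), ← expect_add]
  refine expect_congr _ fun t ht => ?_
  rw [sigmaDist_weights, Real.log_mul (pos_of_mem hs).ne' (pos_of_mem ht).ne']
  ring

end SigmaDist

open Classical in
/-- The distribution `p` conditioned on `f = s`; it is `p` itself if `f = s` has probability
zero. -/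
noncomputable def condDist (p : Distribution S) (f : S → T) (s : T) : Distribution S :=
  -- The default value makes conditioning total and keeps its support inside that of `p` for every
  -- `s`. Such `s` have no weight in the averages over `p.map f`.
  if h : ∃ x ∈ f ⁻¹' {s}, p.weights x ≠ 0 then p.restrict (f ⁻¹' {s}) h else p

lemma condDist_of_exists (p : Distribution S) (f : S → T) {s : T}
    (h : ∃ x ∈ f ⁻¹' {s}, p.weights x ≠ 0) : condDist p f s = p.restrict (f ⁻¹' {s}) h :=
  dif_pos h

lemma exists_of_mem_map {p : Distribution S} {f : S → T} {s : T}
    (hs : s ∈ (p.map f).weights.support) : ∃ x ∈ f ⁻¹' {s}, p.weights x ≠ 0 := by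
  obtain ⟨x, hx, rfl⟩ := exists_of_mem_support_map hs
  exact ⟨x, rfl, Finsupp.mem_support_iff.1 hx⟩

lemma condDist_support_subset (p : Distribution S) (f : S → T) (s : T) :
    (condDist p f s).weights.support ⊆ p.weights.support := by
  classical
  unfold condDist
  split_ifs with h
  · rw [Convexity.StdSimplex.support_weights_restrict]
    exact Finset.filter_subset _ _
  · rfl

lemma eq_of_mem_support_condDist {p : Distribution S} {f : S → T} {s : T}
    (hs : s ∈ (p.map f).weights.support) {x : S} (hx : x ∈ (condDist p f s).weights.support) :
    f x = s := by
  classical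
  rw [condDist_of_exists p f (exists_of_mem_map hs),
    Convexity.StdSimplex.support_weights_restrict] at hx
  exact (Finset.mem_filter.1 hx).2

open Classical in
lemma expect_condDist {p : Distribution S} {f : S → T} {s : T}
    (hs : s ∈ (p.map f).weights.support) (F : S → ℝ) :
    expect (condDist p f s) F
      = ((p.map f).weights s)⁻¹ * expect p fun x => if f x = s then F x else 0 := by
  have hc : (p.weights.filter (· ∈ f ⁻¹' {s})).sum (fun _ k => k) = (p.map f).weights s := by
    rw [map_weights_apply, expect_eq, Finsupp.sum_filter_index, Finsupp.support_filter,
      Finset.sum_filter]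
    exact Finset.sum_congr rfl fun x _ => by simp
  have hsup : (condDist p f s).weights.support = p.weights.support.filter (· ∈ f ⁻¹' {s}) := by
    rw [condDist_of_exists p f (exists_of_mem_map hs),
      Convexity.StdSimplex.support_weights_restrict]
  rw [expect_eq, expect_eq, hsup, Finset.sum_filter, Finset.mul_sum]
  refine Finset.sum_congr rfl fun x _ => ?_
  rw [condDist_of_exists p f (exists_of_mem_map hs), Convexity.StdSimplex.weights_restrict, hc]
  by_cases hx : f x = s <;> simp [hx, mul_assoc]

lemma expect_expect_condDist (p : Distribution S) (f : S → T) (F : S → ℝ) :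
    expect (p.map f) (fun s => expect (condDist p f s) F) = expect p F := by
  classical
  have h : ∀ s ∈ (p.map f).weights.support, (p.map f).weights s * expect (condDist p f s) F
      = expect p fun x => if f x = s then F x else 0 := fun s hs => by
    rw [expect_condDist hs, mul_inv_cancel_left₀ (pos_of_mem hs).ne']
  rw [expect_eq, Finset.sum_congr rfl h, ← expect_sum]
  refine expect_congr p fun x hx => ?_
  rw [Finset.sum_ite_eq, if_pos (mem_support_map f hx)]

lemma sigmaDist_condDist_map_snd (p : Distribution S) (f : S → T) :
    (sigmaDist (p.map f) fun s => condDist p f s).map (fun x => x.2) = p := by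
  refine dist_ext fun F => ?_
  rw [expect_map, expect_sigma]
  exact expect_expect_condDist p f F

/-- Drawing the value `s` of `f` and then a value of `g` under `p` given `s` amounts to drawing one
point of `p`. The one-point form is symmetric in `f` and `g`, which permits exchanging the order of
conditioning. -/
lemma expectVec_condDist_map {M : Type*} [AddCommMonoid M] [Module ℝ≥0 M] (p : Distribution S)
    (f : S → T) (g : S → C) (Φ : T → C → M) :
    expectVec (p.map f) (fun s => expectVec ((condDist p f s).map g) (Φ s))
      = expectVec p fun x => Φ (f x) (g x) := by
  have h : expectVec p (fun x => Φ (f x) (g x))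
      = expectVec (p.map f) fun s => expectVec (condDist p f s) fun x => Φ (f x) (g x) := by
    conv_lhs => rw [← sigmaDist_condDist_map_snd p f]
    rw [expectVec_map, expectVec_sigma]
  rw [h]
  refine expectVec_congr _ fun s hs => ?_
  rw [expectVec_map]
  exact expectVec_congr _ fun x hx => by rw [eq_of_mem_support_condDist hs hx]

/-- The conditioning event depends only on the image under `k`, so it may be imposed before or after
pushing forward. -/
lemma condDist_map (p : Distribution S) (k : S → T) (h : T → C) {s : C}
    (hs : s ∈ (p.map fun x => h (k x)).weights.support) :
    (condDist p (fun x => h (k x)) s).map k = condDist (p.map k) h s := by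
  classical
  have hs' : s ∈ ((p.map k).map h).weights.support := by rwa [Convexity.StdSimplex.map_map]
  refine dist_ext fun F => ?_
  rw [expect_map, expect_condDist hs, expect_condDist hs', expect_map,
    Convexity.StdSimplex.map_map]

lemma mem_support_map_condDist {p : Distribution S} {f : S → T} {g : S → C} {x : S}
    (hx : x ∈ p.weights.support) : g x ∈ ((condDist p f (f x)).map g).weights.support := by
  classical
  refine mem_support_map g ?_
  rw [condDist_of_exists p f (exists_of_mem_map (mem_support_map f hx)),
    Convexity.StdSimplex.support_weights_restrict]
  exact Finset.mem_filter.2 ⟨hx, rfl⟩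

lemma condDist_comm (p : Distribution S) (f : S → T) (g : S → C) {x : S}
    (hx : x ∈ p.weights.support) :
    condDist (condDist p f (f x)) g (g x) = condDist (condDist p g (g x)) f (f x) := by
  classical
  -- Iterated conditioning is conditioning on the joint event, in which the order plays no role.
  have key : ∀ {T C : Type} (f : S → T) (g : S → C) (F : S → ℝ),
      expect (condDist (condDist p f (f x)) g (g x)) F
        = (expect p fun y => if f y = f x ∧ g y = g x then 1 else 0)⁻¹ *
          expect p fun y => if f y = f x ∧ g y = g x then F y else 0 := by
    intro T C f g F
    have hf := mem_support_map f hx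
    have h0 := (pos_of_mem hf).ne'
    rw [expect_condDist (mem_support_map_condDist hx), map_weights_apply, expect_condDist hf,
      expect_condDist hf, mul_inv, inv_inv]
    simp only [ite_and]
    field_simp
  refine dist_ext fun F => ?_
  rw [key, key]
  simp only [and_comm]

/-- The chain rule for entropy. -/
lemma entropy_map_prodMk (p : Distribution S) (f : S → T) (k : S → C) :
    entropy (p.map fun x => (f x, k x))
      = entropy (p.map f) + expect (p.map f) fun s => entropy ((condDist p f s).map k) := by
  rw [← entropy_sigma (T := fun _ => C), ← entropy_map_of_injective (sigmaDist _ _)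
    (f := fun x : (Σ _ : T, C) => (x.1, x.2))]
  · congr 1
    refine dist_ext fun F => ?_
    rw [expect_map, expect_map, expect_sigma,
      ← expect_expect_condDist p f fun x => F (f x, k x)]
    refine expect_congr _ fun s hs => ?_
    rw [expect_map]
    exact expect_congr _ fun x hx => by rw [eq_of_mem_support_condDist hs hx]
  · rintro ⟨a, b⟩ ⟨c, d⟩ h
    simpa using h

/-- Concavity of entropy: averaging over an index increases the entropy. -/
lemma expect_entropy_le (p : Distribution S) (μ : S → Distribution T) :
    expect p (fun s => entropy (μ s))
      ≤ entropy ((sigmaDist p μ).map fun x : (Σ _ : S, T) => x.2) := by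
  set c := (sigmaDist p μ).map fun x : (Σ _ : S, T) => (x.1, x.2) with hc
  have h1 : entropy c = entropy p + expect p fun s => entropy (μ s) := by
    rw [← entropy_sigma, hc, entropy_map_of_injective]
    rintro ⟨a, b⟩ ⟨c, d⟩ h
    simpa using h
  have h2 : c.map Prod.fst = p := by
    refine dist_ext fun F => ?_
    rw [hc, expect_map, expect_map, expect_sigma]
    simp [expect_const]
  -- Over a one-point common image, submodularity becomes `H(index, value) ≤ H(index) + H(value)`.
  -- By the chain rule the left side is `H(index)` plus the average entropy.
  have h3 := entropy_submod c (fun _ => ()) (fun _ => ()) fun _ _ => rfl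
  rw [h2, h1, hc, Convexity.StdSimplex.map_map] at h3
  have h4 := entropy_nonneg (p.map fun _ : S => ())
  linarith

end Distributions

end TropProb

namespace TropProb

/-! ### Mixtures of diagrams and their entropy distances. -/

section Mixtures

variable {G : Type*} [PartialOrder G] {S T : Type}

/-- The mixture of a family of diagrams, in which every space remembers the index. -/
noncomputable def Diagram.mix (p : Distribution S) (F : S → Diagram G) : Diagram G where
  space i := Σ s, (F s).space i
  law i := sigmaDist p fun s => (F s).law i
  map h := fun x => ⟨x.1, (F x.1).map h x.2⟩
  map_law {i j} h := by
    refine dist_ext fun H => ?_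
    rw [expect_map, expect_sigma, expect_sigma]
    refine expect_congr p fun s _ => ?_
    rw [← (F s).map_law h, expect_map]
  map_refl i := by
    rintro ⟨s, x⟩ hx
    simp only [(F s).map_refl i x ((mem_support_sigma _ _).1 hx).2]
  map_trans h h' := by
    rintro ⟨s, x⟩ hx
    simp only [(F s).map_trans h h' x ((mem_support_sigma _ _).1 hx).2]

lemma Diagram.ent_mix (p : Distribution S) (F : S → Diagram G) (i : G) :
    (Diagram.mix p F).ent i = entropy p + expect p fun s => (F s).ent i := entropy_sigma _ _

/-- The reduction of mixtures induced by a family of reductions. -/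
def Reduction.mix (p : Distribution S) {F H : S → Diagram G} (r : ∀ s, Reduction (F s) (H s)) :
    Reduction (Diagram.mix p F) (Diagram.mix p H) where
  app i := fun x => ⟨x.1, (r x.1).app i x.2⟩
  map_law i := by
    refine dist_ext fun φ => ?_
    refine (expect_map _ _ _).trans ?_
    refine (expect_sigma _ _ _).trans (Eq.trans ?_ (expect_sigma _ _ _).symm)
    refine expect_congr p fun s _ => ?_
    rw [← (r s).map_law i, expect_map]
  naturality h := by
    rintro ⟨s, x⟩ hx
    exact Sigma.ext rfl (heq_of_eq ((r s).naturality h x ((mem_support_sigma _ _).1 hx).2))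

/-- The reduction of a mixture induced by a family of reductions to the same diagram. -/
def Reduction.mixDesc (p : Distribution S) {F : S → Diagram G} {B : Diagram G}
    (r : ∀ s, Reduction (F s) B) : Reduction (Diagram.mix p F) B where
  app i := fun x => (r x.1).app i x.2
  map_law i := by
    refine dist_ext fun φ => ?_
    rw [expect_map]
    refine (expect_sigma _ _ _).trans ?_
    rw [← expect_const p (expect (B.law i) φ)]
    refine expect_congr p fun s _ => ?_
    rw [← (r s).map_law i, expect_map]
  naturality h := by
    rintro ⟨s, x⟩ hx
    exact (r s).naturality h x ((mem_support_sigma _ _).1 hx).2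

/-- The tensor product of mixtures is the mixture of the tensor products. -/
def Reduction.mixTensor (p : Distribution S) (q : Distribution T) (F : S → Diagram G)
    (H : T → Diagram G) :
    Reduction ((Diagram.mix p F).tensor (Diagram.mix q H))
      (Diagram.mix (tensorDist p q) fun x => (F x.1).tensor (H x.2)) where
  app i := fun x => ⟨(x.1.1, x.2.1), (x.1.2, x.2.2)⟩
  map_law i := by
    refine dist_ext fun φ => ?_
    refine (expect_map _ _ _).trans ?_
    refine (expect_tensor _ _ _).trans (Eq.trans ?_ (expect_sigma _ _ _).symm)
    refine (expect_sigma _ _ _).trans (Eq.trans ?_ (expect_tensor _ _ _).symm)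
    refine expect_congr p fun s _ => ?_
    refine Eq.trans (expect_congr _ fun x _ => expect_sigma _ _ _) ?_
    rw [expect_comm]
    exact expect_congr _ fun t _ =>
      (expect_tensor ((F s).law i) ((H t).law i) fun x => φ ⟨(s, t), x⟩).symm
  naturality _ _ _ := rfl

variable [Fintype G]

lemma ikd_mix_tensor (p : Distribution S) (q : Distribution T) (F : S → Diagram G)
    (H : T → Diagram G) :
    ikd ((Diagram.mix p F).tensor (Diagram.mix q H))
      (Diagram.mix (tensorDist p q) fun x => (F x.1).tensor (H x.2)) = 0 := by
  refine ikd_eq_zero (Reduction.mixTensor p q F H) fun i => ?_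
  simp only [Diagram.ent_tensor, Diagram.ent_mix, entropy_tensor, expect_add, expect_tensor,
    expect_const]
  ring

/-- Nearly optimal fans `F s ← K s → B` are mixed into one fan. The index is present in the top and
in the left foot but not in `B`, so it adds `H(p)` to the distance at each object, and the remaining
terms average. -/
lemma ikd_mix_le (p : Distribution S) (F : S → Diagram G) (B : Diagram G) :
    ikd (Diagram.mix p F) B ≤ Fintype.card G * entropy p + expect p fun s => ikd (F s) B := by
  refine le_of_forall_pos_le_add fun ε hε => ?_
  have h : ∀ s, ∃ K : Fan (F s) B, K.kd < ikd (F s) B + ε := fun s =>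
    exists_lt_of_ciInf_lt (lt_add_of_pos_right _ hε)
  choose K hK using h
  refine (ikd_le ⟨Diagram.mix p fun s => (K s).top, Reduction.mix p fun s => (K s).left,
    Reduction.mixDesc p fun s => (K s).right⟩).trans ?_
  have h1 : expect p (fun s => (K s).kd) ≤ expect p (fun s => ikd (F s) B) + ε := by
    rw [← expect_const p ε, ← expect_add]
    exact expect_mono p fun s _ => (hK s).le
  refine le_trans (le_of_eq ?_) ((add_le_add_right h1 (Fintype.card G * entropy p)).trans
    (add_assoc _ _ _).ge)
  simp only [Fan.kd_eq, expect_sum, expect_sub, expect_const_mul, expect_const, Diagram.ent_mix]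
  rw [← nsmul_eq_mul, ← Finset.card_univ, ← Finset.sum_const, ← Finset.sum_add_distrib]
  exact Finset.sum_congr rfl fun i _ => by ring

end Mixtures

/-! ### Diagrams conditioned on a function of the initial space. -/

section Conditioning

variable {G : Type*} [PartialOrder G] [OrderBot G] {S T : Type}

/-- The diagram with the sets and maps of `X` whose initial law is `μ`. -/
noncomputable def Diagram.withInitialLaw (X : Diagram G) (μ : Distribution (X.space ⊥))
    (hμ : μ.weights.support ⊆ (X.law ⊥).weights.support) : Diagram G where
  space := X.space
  law i := μ.map (X.map (bot_le : ⊥ ≤ i))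
  map := X.map
  map_law h := by
    rw [Convexity.StdSimplex.map_map]
    exact map_congr _ fun x hx => X.map_trans _ h x (hμ hx)
  map_refl i x hx := by
    obtain ⟨y, hy, rfl⟩ := exists_of_mem_support_map hx
    exact X.map_refl i _ (X.map_bot_support (hμ hy))
  map_trans h h' x hx := by
    obtain ⟨y, hy, rfl⟩ := exists_of_mem_support_map hx
    exact X.map_trans h h' _ (X.map_bot_support (hμ hy))

lemma Diagram.withInitialLaw_congr (X : Diagram G) {μ ν : Distribution (X.space ⊥)} (h : μ = ν)
    (hμ : μ.weights.support ⊆ (X.law ⊥).weights.support)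
    (hν : ν.weights.support ⊆ (X.law ⊥).weights.support) :
    X.withInitialLaw μ hμ = X.withInitialLaw ν hν := by
  subst h
  rfl

/-- The diagram `X` conditioned on the value `s` of a function `f` on the initial space. -/
noncomputable def Diagram.condOn (X : Diagram G) (f : X.space ⊥ → S) (s : S) : Diagram G :=
  X.withInitialLaw (condDist (X.law ⊥) f s) (condDist_support_subset _ _ _)

/-- Conditioning on an arbitrary function of the initial space also makes sense on the top of a fan,
where the function comes from a foot and need not come from a space of the diagram. -/
lemma Diagram.cond_eq_condOn (X : Diagram G) (ι : G) (u : (X.law ι).weights.support) :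
    X.cond ι u = X.condOn (X.map (bot_le : ⊥ ≤ ι)) (u : X.space ι) := by
  refine X.withInitialLaw_congr (μ := X.condInitialLaw ι u) ?_
    (fun _ => X.condInitialLaw_support ι u) (condDist_support_subset _ _ _)
  rw [condDist_of_exists]
  rfl

lemma Diagram.condOn_law_bot (X : Diagram G) (f : X.space ⊥ → S) (s : S) :
    (X.condOn f s).law ⊥ = condDist (X.law ⊥) f s := by
  refine (map_congr (g := id) _ fun x hx => ?_).trans (Convexity.StdSimplex.map_id _)
  exact X.map_refl ⊥ x (condDist_support_subset _ _ _ hx)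

/-- Both sides keep the sets and maps of `X`, so the commutation of the initial laws gives a genuine
equality of diagrams. -/
lemma Diagram.condOn_comm (X : Diagram G) (f : X.space ⊥ → S) (g : X.space ⊥ → T)
    {x : X.space ⊥} (hx : x ∈ (X.law ⊥).weights.support) :
    (X.condOn f (f x)).condOn g (g x) = (X.condOn g (g x)).condOn f (f x) := by
  have h1 := condDist_support_subset ((X.condOn f (f x)).law ⊥) g (g x)
  have h2 := condDist_support_subset ((X.condOn g (g x)).law ⊥) f (f x)
  refine X.withInitialLaw_congr (μ := condDist ((X.condOn f (f x)).law ⊥) g (g x))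
    (ν := condDist ((X.condOn g (g x)).law ⊥) f (f x)) ?_ (h1.trans ?_) (h2.trans ?_)
  · rw [X.condOn_law_bot, X.condOn_law_bot, condDist_comm _ _ _ hx]
  · rw [X.condOn_law_bot]
    exact condDist_support_subset _ _ _
  · rw [X.condOn_law_bot]
    exact condDist_support_subset _ _ _

/-- Conditioning is compatible with reductions. -/
def Reduction.condOn {X Y : Diagram G} (r : Reduction X Y) (f : Y.space ⊥ → S) {s : S}
    (hs : s ∈ ((Y.law ⊥).map f).weights.support) :
    Reduction (X.condOn (fun x => f (r.app ⊥ x)) s) (Y.condOn f s) where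
  app := r.app
  map_law i := by
    have hs' : s ∈ ((X.law ⊥).map fun x => f (r.app ⊥ x)).weights.support := by
      rwa [← Convexity.StdSimplex.map_map, r.map_law]
    change ((condDist _ _ _).map (X.map (bot_le : ⊥ ≤ i))).map (r.app i)
      = (condDist _ _ _).map (Y.map (bot_le : ⊥ ≤ i))
    rw [← r.map_law ⊥, ← condDist_map _ _ _ hs', Convexity.StdSimplex.map_map,
      Convexity.StdSimplex.map_map]
    exact map_congr _ fun x hx => r.naturality _ x (condDist_support_subset _ _ _ hx)
  naturality h x hx := by
    obtain ⟨y, hy, rfl⟩ := exists_of_mem_support_map hx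
    exact r.naturality h _ (X.map_bot_support (condDist_support_subset _ _ _ hy))

/-- A mixture of the diagrams conditioned on the values of `f` reduces to the diagram. -/
def Reduction.ofMixCond (X : Diagram G) (f : X.space ⊥ → S) :
    Reduction (Diagram.mix ((X.law ⊥).map f) fun s => X.condOn f s) X where
  app _ := fun x => x.2
  map_law i := by
    refine dist_ext fun φ => ?_
    rw [← X.map_law (bot_le : ⊥ ≤ i), expect_map (X.law ⊥), ← expect_expect_condDist _ f]
    refine (expect_map _ _ _).trans ?_
    refine (expect_sigma _ _ _).trans (expect_congr _ fun s _ => ?_)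
    exact expect_map _ _ _
  naturality _ _ _ := rfl

variable [Fintype G]

/-- Forgetting the index is a reduction onto `X`. Its defect at `i` is `H(f) + H(X_i | f) - H(X_i)`,
which is at most `H(f)` by concavity of entropy. -/
lemma ikd_mix_condOn_le (X : Diagram G) (f : X.space ⊥ → S) :
    ikd (Diagram.mix ((X.law ⊥).map f) fun s => X.condOn f s) X
      ≤ Fintype.card G * entropy ((X.law ⊥).map f) := by
  refine (ikd_le ⟨_, Reduction.refl _, Reduction.ofMixCond X f⟩).trans ?_
  rw [Fan.kd_eq, ← nsmul_eq_mul, ← Finset.card_univ, ← Finset.sum_const]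
  refine Finset.sum_le_sum fun i _ => ?_
  have h := expect_entropy_le ((X.law ⊥).map f) fun s => (X.condOn f s).law i
  have h' : expect ((X.law ⊥).map f) (fun s => (X.condOn f s).ent i) ≤ X.ent i :=
    h.trans_eq (congrArg entropy ((Reduction.ofMixCond X f).map_law i))
  rw [Diagram.ent_mix]
  linarith

end Conditioning

end TropProb

namespace TropProb

/-! ### Distances that are subadditive under addition. -/

section SubadditiveDist

variable {M ι : Type*} [AddCommMonoid M] [PseudoMetricSpace M]

/-- Stated for an abstract monoid because it is needed both for diagram classes and for tropical
diagrams. -/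
lemma dist_sum_sum_le_of_subadditive
    (h : ∀ a b c d : M, dist (a + b) (c + d) ≤ dist a c + dist b d)
    (A : Finset ι) (f g : ι → M) : dist (∑ i ∈ A, f i) (∑ i ∈ A, g i) ≤ ∑ i ∈ A, dist (f i) (g i) := by
  classical
  induction A using Finset.induction_on with
  | empty => simp
  | insert i A hi ih =>
    rw [Finset.sum_insert hi, Finset.sum_insert hi, Finset.sum_insert hi]
    exact (h _ _ _ _).trans (add_le_add_right ih _)

/-- The smaller multiple is common to both sides, and each surplus copy of `x` is compared with `0`.
-/
lemma dist_nsmul_nsmul_le_of_subadditive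
    (h : ∀ a b c d : M, dist (a + b) (c + d) ≤ dist a c + dist b d) (m n : ℕ) (x : M) :
    dist (m • x) (n • x) ≤ |(m : ℝ) - n| * dist x 0 := by
  have h0 : ∀ k : ℕ, dist (k • x) 0 ≤ k * dist x 0 := fun k => by
    have := dist_sum_sum_le_of_subadditive h (Finset.range k) (fun _ => x) (fun _ => 0)
    simpa using this
  have key : ∀ m k : ℕ, dist ((m + k) • x) (m • x) ≤ k * dist x 0 := fun m k => by
    have := h (m • x) (k • x) (m • x) 0
    rw [dist_self, zero_add, add_zero, ← add_smul] at this
    exact this.trans (h0 k)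
  rcases le_total m n with hmn | hmn <;> obtain ⟨k, rfl⟩ := Nat.exists_eq_add_of_le hmn
  · rw [dist_comm]
    simpa using key m k
  · simpa using key n k

end SubadditiveDist

variable {G : Type*} [PartialOrder G] [Fintype G] [OrderBot G]

/-! ### Diagrams up to intrinsic entropy distance zero -/

noncomputable instance : PseudoMetricSpace (Diagram G) where
  dist := ikd
  dist_self := ikd_self
  dist_comm := ikd_symm
  dist_triangle := ikd_triangle

/-- The commutative monoid of diagrams up to intrinsic entropy distance zero. -/
def DiagramClass (G : Type*) [PartialOrder G] [Fintype G] [OrderBot G] : Type _ :=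
  SeparationQuotient (Diagram G)

namespace DiagramClass

noncomputable instance : MetricSpace (DiagramClass G) :=
  inferInstanceAs (MetricSpace (SeparationQuotient (Diagram G)))

/-- The class of a diagram. -/
noncomputable def mk (X : Diagram G) : DiagramClass G := SeparationQuotient.mk X

lemma dist_mk (X Y : Diagram G) : dist (mk X) (mk Y) = ikd X Y := SeparationQuotient.dist_mk X Y

lemma mk_surjective : Function.Surjective (mk : Diagram G → DiagramClass G) :=
  SeparationQuotient.surjective_mk

lemma mk_eq {X Y : Diagram G} (h : ikd X Y = 0) : mk X = mk Y :=
  dist_eq_zero.1 ((dist_mk X Y).trans h)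

noncomputable instance : Add (DiagramClass G) where
  add := Quotient.map₂ Diagram.tensor fun _ _ h _ _ h' =>
    Metric.inseparable_iff.2 (ikd_zero_tensor (Metric.inseparable_iff.1 h)
      (Metric.inseparable_iff.1 h'))

lemma mk_tensor (X Y : Diagram G) : mk (X.tensor Y) = mk X + mk Y := rfl

noncomputable instance : Zero (DiagramClass G) := ⟨mk (Diagram.trivial G)⟩

lemma mk_trivial : mk (Diagram.trivial G) = 0 := rfl

lemma add_comm' (a b : DiagramClass G) : a + b = b + a := by
  obtain ⟨X, rfl⟩ := mk_surjective a
  obtain ⟨Y, rfl⟩ := mk_surjective b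
  exact mk_eq (ikd_comm X Y)

lemma add_zero' (a : DiagramClass G) : a + 0 = a := by
  obtain ⟨X, rfl⟩ := mk_surjective a
  exact mk_eq (ikd_tensor_trivial X)

noncomputable instance : AddCommMonoid (DiagramClass G) where
  add_assoc a b c := by
    obtain ⟨X, rfl⟩ := mk_surjective a
    obtain ⟨Y, rfl⟩ := mk_surjective b
    obtain ⟨Z, rfl⟩ := mk_surjective c
    exact mk_eq (ikd_assoc X Y Z)
  zero_add a := (add_comm' 0 a).trans (add_zero' a)
  add_zero := add_zero'
  add_comm := add_comm'
  nsmul := nsmulRec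

lemma dist_add_add_le (a b c d : DiagramClass G) :
    dist (a + b) (c + d) ≤ dist a c + dist b d := by
  obtain ⟨X, rfl⟩ := mk_surjective a
  obtain ⟨Y, rfl⟩ := mk_surjective b
  obtain ⟨Z, rfl⟩ := mk_surjective c
  obtain ⟨W, rfl⟩ := mk_surjective d
  simp only [← mk_tensor, dist_mk]
  exact ikd_tensor_le _ _ _ _

/-- In the quotient, reordering and regrouping of tensor factors become equalities, so a product of
diagrams is determined by the multiplicities of its factors. -/
lemma mk_pow (X : Diagram G) (n : ℕ) : mk (X.pow n) = n • mk X := by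
  induction n with
  | zero => rw [zero_smul]; rfl
  | succ n ih => rw [succ_nsmul, ← ih]; rfl

end DiagramClass

/-! ### Homogeneity of the asymptotic entropy distance. -/

lemma ikd_pow_mul (X : Diagram G) (m n : ℕ) : ikd (X.pow (m * n)) ((X.pow m).pow n) = 0 := by
  rw [← DiagramClass.dist_mk, DiagramClass.mk_pow, DiagramClass.mk_pow, DiagramClass.mk_pow,
    mul_nsmul, dist_self]

lemma aikd_pow_le (X Y : Diagram G) (n : ℕ) : aikd (X.pow n) (Y.pow n) ≤ n * aikd X Y := by
  induction n with
  | zero =>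
    rw [Nat.cast_zero, zero_mul]
    exact (aikd_self (Diagram.trivial G)).le
  | succ n ih =>
    refine (aikd_tensor_le _ _ _ _).trans ?_
    push_cast
    linarith

/-- The limit defining the distance of `X` and `Y` may be taken along the multiples of `n`, where
the powers are powers of `X ^ n` and `Y ^ n`. With `aikd_pow_le` this makes the distance exactly
homogeneous. -/
lemma mul_aikd_le (X Y : Diagram G) (n : ℕ) : n * aikd X Y ≤ aikd (X.pow n) (Y.pow n) := by
  rcases Nat.eq_zero_or_pos n with rfl | hn
  · rw [Nat.cast_zero, zero_mul]
    exact aikd_nonneg _ _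
  have h1 := ((tendsto_aikd X Y).comp (tendsto_id.const_mul_atTop' hn)).const_mul (n : ℝ)
  refine le_of_tendsto_of_tendsto' h1 (tendsto_aikd (X.pow n) (Y.pow n)) fun m => ?_
  have hn' : (n : ℝ) ≠ 0 := by exact_mod_cast hn.ne'
  have h2 := ikd_le_of_zero (ikd_pow_mul X n m) (ikd_pow_mul Y n m)
  simp only [Function.comp, id, Nat.cast_mul]
  rw [← mul_div_assoc, mul_div_mul_left _ _ hn']
  exact div_le_div_of_nonneg_right h2 m.cast_nonneg

/-! ### The metric cone of tropical diagrams and the classes of single diagrams. -/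

namespace TropicalDiagram

variable {φ : AdmissibleFunction}

lemma dist_add_add_le (a b c d : TropicalDiagram G φ) :
    dist (a + b) (c + d) ≤ dist a c + dist b d := by
  obtain ⟨X, rfl⟩ := mk_surjective a
  obtain ⟨Y, rfl⟩ := mk_surjective b
  obtain ⟨Z, rfl⟩ := mk_surjective c
  obtain ⟨W, rfl⟩ := mk_surjective d
  simp only [mk_add, dist_mk]
  exact QuasiLinear.dist_tensor_le X Y Z W

lemma dist_smul_smul (r : ℝ≥0) (a b : TropicalDiagram G φ) :
    dist (r • a) (r • b) = r * dist a b := by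
  obtain ⟨X, rfl⟩ := mk_surjective a
  obtain ⟨Y, rfl⟩ := mk_surjective b
  simp only [smul_mk, dist_mk]
  exact QuasiLinear.dist_scale r X Y

/-- The larger scalar is the smaller one plus a difference `k`, and `k • a` is compared with `k • 0
= 0`. -/
lemma dist_smul_left_le (r s : ℝ≥0) (a : TropicalDiagram G φ) :
    dist (r • a) (s • a) ≤ |(r : ℝ) - s| * dist a 0 := by
  have key : ∀ r k : ℝ≥0, dist ((r + k) • a) (r • a) ≤ k * dist a 0 := fun r k => by
    have h := dist_add_add_le (r • a) (k • a) (r • a) (k • 0)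
    rwa [dist_self, zero_add, smul_zero, add_zero, ← add_smul, ← smul_zero k, dist_smul_smul] at h
  rcases le_total r s with h | h <;> obtain ⟨k, rfl⟩ := exists_add_of_le h
  · rw [dist_comm]
    simpa using key r k
  · simpa using key s k

instance : ContinuousAdd (TropicalDiagram G φ) where
  continuous_add := by
    refine continuous_iff_continuousAt.2 fun ⟨a, b⟩ => tendsto_iff_dist_tendsto_zero.2 ?_
    have h : Tendsto (fun x : TropicalDiagram G φ × TropicalDiagram G φ =>
        dist x.1 a + dist x.2 b) (𝓝 (a, b)) (𝓝 (dist a a + dist b b)) :=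
      Continuous.tendsto (by fun_prop) (a, b)
    rw [dist_self, dist_self, add_zero] at h
    exact squeeze_zero (fun _ => dist_nonneg) (fun x => dist_add_add_le _ _ _ _) h

instance : ContinuousSMul ℝ≥0 (TropicalDiagram G φ) where
  continuous_smul := by
    refine continuous_iff_continuousAt.2 fun ⟨r, a⟩ => tendsto_iff_dist_tendsto_zero.2 ?_
    have h : Tendsto (fun x : ℝ≥0 × TropicalDiagram G φ =>
        (x.1 : ℝ) * dist x.2 a + |(x.1 : ℝ) - r| * dist a 0) (𝓝 (r, a))
        (𝓝 (r * dist a a + |(r : ℝ) - r| * dist a 0)) :=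
      Continuous.tendsto (f := fun x : ℝ≥0 × TropicalDiagram G φ =>
        (x.1 : ℝ) * dist x.2 a + |(x.1 : ℝ) - r| * dist a 0) (by fun_prop) (r, a)
    rw [dist_self, sub_self, abs_zero, mul_zero, zero_mul, add_zero] at h
    refine squeeze_zero (fun _ => dist_nonneg) (fun x => ?_) h
    refine (dist_triangle _ (x.1 • a) _).trans (add_le_add ?_ (dist_smul_left_le _ _ _))
    exact (dist_smul_smul _ _ _).le

lemma dist_expectVec_le {S : Type} (p : Distribution S) (f g : S → TropicalDiagram G φ) :
    dist (expectVec p f) (expectVec p g) ≤ expect p fun s => dist (f s) (g s) := by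
  refine (dist_sum_sum_le_of_subadditive dist_add_add_le _ _ _).trans (le_of_eq ?_)
  rw [expect_eq]
  refine Finset.sum_congr rfl fun s _ => ?_
  rw [dist_smul_smul, Real.coe_toNNReal _ (p.nonneg s)]

/-- The class of the linear sequence of a diagram. -/
noncomputable def ofDiagram (φ : AdmissibleFunction) (X : Diagram G) : TropicalDiagram G φ :=
  mk (QuasiLinear.linear φ X)

/-- By homogeneity the sequence whose limit is the distance is constant for positive `n`. -/
lemma dist_ofDiagram (X Y : Diagram G) :
    dist (ofDiagram φ X) (ofDiagram φ Y) = aikd X Y := by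
  refine tendsto_nhds_unique ((QuasiLinear.linear φ X).tendsto_asympDist
    (QuasiLinear.linear φ Y)) (tendsto_const_nhds.congr' ?_)
  filter_upwards [eventually_gt_atTop 0] with n hn
  rw [eq_div_iff (by exact_mod_cast hn.ne'), mul_comm]
  exact le_antisymm (mul_aikd_le X Y n) (aikd_pow_le X Y n)

lemma dist_ofDiagram_le (X Y : Diagram G) :
    dist (ofDiagram φ X) (ofDiagram φ Y) ≤ ikd X Y :=
  (dist_ofDiagram X Y).trans_le (aikd_le_ikd X Y)

lemma ofDiagram_eq {X Y : Diagram G} (h : ikd X Y = 0) : ofDiagram φ X = ofDiagram φ Y :=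
  dist_eq_zero.1 (le_antisymm ((dist_ofDiagram_le X Y).trans h.le) dist_nonneg)

lemma ofDiagram_tensor (X Y : Diagram G) :
    ofDiagram φ (X.tensor Y) = ofDiagram φ X + ofDiagram φ Y :=
  mk_eq (QuasiLinear.dist_eq_zero_of_forall fun n => ikd_tensor_pow X Y n)

lemma ofDiagram_trivial : ofDiagram φ (Diagram.trivial G) = 0 := rfl

lemma ofDiagram_pow (X : Diagram G) (n : ℕ) : ofDiagram φ (X.pow n) = n • ofDiagram φ X := by
  induction n with
  | zero => rw [zero_smul]; rfl
  | succ n ih => rw [succ_nsmul, ← ih]; exact ofDiagram_tensor _ _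

/-- The class of the linear sequence of a diagram, as a homomorphism from diagram classes. -/
noncomputable def ofDiagramClass (φ : AdmissibleFunction) :
    DiagramClass G →+ TropicalDiagram G φ where
  toFun := Quotient.lift (ofDiagram φ) fun _ _ h => ofDiagram_eq (Metric.inseparable_iff.1 h)
  map_zero' := rfl
  map_add' a b := by
    obtain ⟨X, rfl⟩ := DiagramClass.mk_surjective a
    obtain ⟨Y, rfl⟩ := DiagramClass.mk_surjective b
    exact ofDiagram_tensor X Y

lemma ofDiagramClass_mk (X : Diagram G) :
    ofDiagramClass φ (DiagramClass.mk X) = ofDiagram φ X := rfl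

end TropicalDiagram

end TropProb

/-! ### Mixtures as convex combinations: a weak law of large numbers. -/

namespace TropProb

variable {G : Type*} [PartialOrder G] [Fintype G] [OrderBot G] {S : Type} {φ : AdmissibleFunction}

lemma Diagram.ikd_mix_single_trivial :
    ikd (Diagram.trivial G) (Diagram.mix (Convexity.StdSimplex.single ()) fun _ : Unit =>
      Diagram.trivial G) = 0 := by
  rw [ikd_symm]
  refine ikd_eq_zero (Reduction.mixDesc _ fun _ => Reduction.refl _) fun i => ?_
  rw [Diagram.ent_mix]
  simp [Diagram.ent_trivial, expect_const, entropy]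

/-- A tensor power of a mixture is a mixture of tensor products, in which the multiplicities of
the factors have the variance of a binomial distribution. -/
lemma exists_mix_pow (p : Distribution S) (F : S → Diagram G) (n : ℕ) :
    ∃ (T : Type) (q : Distribution T) (H : T → Diagram G) (N : T → S → ℕ),
      ikd ((Diagram.mix p F).pow n) (Diagram.mix q H) = 0 ∧
      entropy q = n * entropy p ∧
      (∀ t ∈ q.weights.support, DiagramClass.mk (H t)
        = ∑ s ∈ p.weights.support, N t s • DiagramClass.mk (F s)) ∧
      ∀ s, expect q (fun t => ((N t s : ℝ) - n * p.weights s) ^ 2) ≤ n := by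
  classical
  induction n with
  | zero =>
    refine ⟨Unit, Convexity.StdSimplex.single (), fun _ => Diagram.trivial G, fun _ _ => 0,
      Diagram.ikd_mix_single_trivial, by simp [entropy], fun _ _ => ?_, fun s => ?_⟩
    · simp [DiagramClass.mk_trivial]
    · simp [expect_const]
  | succ n ih =>
    obtain ⟨T, q, H, N, h1, h2, h3, h4⟩ := ih
    -- One more independent draw: `N t s` counts how often `s` has been drawn.
    refine ⟨T × S, tensorDist q p, fun x => (H x.1).tensor (F x.2),
      fun x s => N x.1 s + if x.2 = s then 1 else 0,
      ikd_zero_trans (ikd_zero_tensor h1 (ikd_self _)) (ikd_mix_tensor q p H F), ?_, ?_, ?_⟩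
    · rw [entropy_tensor, h2]
      push_cast
      ring
    · intro x hx
      obtain ⟨hx1, hx2⟩ := mem_support_tensor.1 hx
      rw [DiagramClass.mk_tensor, h3 _ hx1]
      simp only [add_smul, Finset.sum_add_distrib, ite_smul, one_smul, zero_smul,
        Finset.sum_ite_eq, if_pos hx2]
    · intro s
      rw [expect_tensor]
      set w := p.weights s
      have hb : expect p (fun b => (if b = s then 1 else 0) - w) = 0 := by
        rw [expect_sub, expect_indicator, expect_const, sub_self]
      have hw0 : 0 ≤ w := p.nonneg s
      have hw1 : w ≤ 1 := calc
        w = expect p fun x => if x = s then 1 else 0 := (expect_indicator p s).symm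
        _ ≤ expect p fun _ => 1 := expect_mono p fun x _ => by split_ifs <;> norm_num
        _ = 1 := expect_const p 1
      -- The new centred indicator is independent of the earlier draws: its cross term has mean zero
      -- and its square is at most `1`, so each draw raises the second moment by at most `1`.
      have key : ∀ a : T, expect p (fun b =>
          (((N a s + if b = s then 1 else 0 : ℕ) : ℝ) - ((n + 1 : ℕ) : ℝ) * w) ^ 2)
            ≤ ((N a s : ℝ) - n * w) ^ 2 + 1 := by
        intro a
        calc _ ≤ expect p (fun b => (((N a s : ℝ) - n * w) ^ 2 + 1)
              + 2 * ((N a s : ℝ) - n * w) * ((if b = s then 1 else 0) - w)) := by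
              refine expect_mono p fun b _ => ?_
              push_cast
              split_ifs <;> nlinarith
          _ = _ := by rw [expect_add, expect_const, expect_const_mul, hb, mul_zero, add_zero]
      refine (expect_mono q fun a _ => key a).trans ?_
      rw [expect_add, expect_const]
      push_cast
      linarith [h4 s]

namespace TropicalDiagram

/-- A mixture is close to the convex combination of its components. -/
lemma dist_ofDiagram_mix_le (p : Distribution S) (F : S → Diagram G) :
    dist (ofDiagram φ (Diagram.mix p F)) (expectVec p fun s => ofDiagram φ (F s))
      ≤ Fintype.card G * entropy p := by
  set d := dist (ofDiagram φ (Diagram.mix p F)) (expectVec p fun s => ofDiagram φ (F s))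
  set E₁ := ∑ s ∈ p.weights.support, dist (DiagramClass.mk (F s)) 0 with hE₁
  set E₂ := ∑ s ∈ p.weights.support, dist (ofDiagram φ (F s)) 0 with hE₂
  have h0 : 0 ≤ E₁ := Finset.sum_nonneg fun _ _ => dist_nonneg
  have h0' : 0 ≤ E₂ := Finset.sum_nonneg fun _ _ => dist_nonneg
  -- The power `m ^ 2` of the mixture is used, so that the multiplicities deviate by about `m`.
  -- After division by `m ^ 2` the error is of order `1 / m`.
  suffices h : ∀ m : ℕ, 1 ≤ m → d ≤ Fintype.card G * entropy p + (3 * E₁ + E₂) / m by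
    refine ge_of_tendsto (x := atTop) (f := fun m : ℕ =>
      Fintype.card G * entropy p + (3 * E₁ + E₂) / m) ?_ ?_
    · simpa using (tendsto_const_div_atTop_nhds_zero_nat (3 * E₁ + E₂)).const_add
        (Fintype.card G * entropy p)
    · filter_upwards [eventually_ge_atTop 1] with m hm using h m hm
  intro m hm
  have hm1 : (1 : ℝ) ≤ m := by exact_mod_cast hm
  have hm0 : (0 : ℝ) < m := by linarith
  obtain ⟨T, q, H, N, h1, h2, h3, h4⟩ := exists_mix_pow p F (m ^ 2)
  set k : S → ℕ := fun s => ⌊((m ^ 2 : ℕ) : ℝ) * p.weights s⌋₊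
  have hk : ∀ s, |(k s : ℝ) - ((m ^ 2 : ℕ) : ℝ) * p.weights s| ≤ 1 := fun s => by
    have l1 := Nat.floor_le (mul_nonneg (m ^ 2 : ℕ).cast_nonneg (p.nonneg s))
    have l2 := Nat.lt_floor_add_one (((m ^ 2 : ℕ) : ℝ) * p.weights s)
    rw [abs_le]
    constructor <;> linarith
  -- A deterministic reference product, in which `F s` occurs the rounded expected number of times.
  obtain ⟨B, hB⟩ := DiagramClass.mk_surjective
    (∑ s ∈ p.weights.support, k s • DiagramClass.mk (F s))
  have e1 : ikd (Diagram.mix q H) B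
      ≤ Fintype.card G * (((m ^ 2 : ℕ) : ℝ) * entropy p) + (2 * m + 1) * E₁ := by
    rw [← h2]
    refine (ikd_mix_le q H B).trans (add_le_add_right ?_ _)
    have hst : ∀ t ∈ q.weights.support, ikd (H t) B ≤ ∑ s ∈ p.weights.support,
        (dist (DiagramClass.mk (F s)) 0 / m * ((N t s : ℝ) - ((m ^ 2 : ℕ) : ℝ) * p.weights s) ^ 2
          + (m + 1) * dist (DiagramClass.mk (F s)) 0) := by
      intro t ht
      rw [← DiagramClass.dist_mk, h3 t ht, hB]
      refine (dist_sum_sum_le_of_subadditive DiagramClass.dist_add_add_le _ _ _).trans ?_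
      refine Finset.sum_le_sum fun s _ => ?_
      refine (dist_nsmul_nsmul_le_of_subadditive DiagramClass.dist_add_add_le _ _ _).trans ?_
      have hd : 0 ≤ dist (DiagramClass.mk (F s)) 0 := dist_nonneg
      set x := (N t s : ℝ) - ((m ^ 2 : ℕ) : ℝ) * p.weights s
      have hx : |(N t s : ℝ) - k s| ≤ |x| + 1 := by
        have := abs_sub_le (N t s : ℝ) (((m ^ 2 : ℕ) : ℝ) * p.weights s) (k s)
        rw [abs_sub_comm (((m ^ 2 : ℕ) : ℝ) * p.weights s) (k s : ℝ)] at this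
        linarith [hk s]
      -- This elementary bound replaces Cauchy–Schwarz. Since the second moment is at most `m ^ 2`,
      -- the mean of the right side is at most `2 * m`.
      have hx2 : |x| ≤ x ^ 2 / m + m := by
        rw [← sq_abs, ← sub_le_iff_le_add, le_div_iff₀ hm0]
        nlinarith [sq_nonneg (|x| - m), abs_nonneg x]
      calc _ ≤ (x ^ 2 / m + m + 1) * dist (DiagramClass.mk (F s)) 0 :=
            mul_le_mul_of_nonneg_right (by linarith) hd
        _ = _ := by ring
    refine (expect_mono q hst).trans ?_
    rw [expect_sum, hE₁, Finset.mul_sum]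
    refine Finset.sum_le_sum fun s _ => ?_
    rw [expect_add, expect_const_mul, expect_const]
    have hd : 0 ≤ dist (DiagramClass.mk (F s)) 0 / m := div_nonneg dist_nonneg hm0.le
    have l1 := mul_le_mul_of_nonneg_left (h4 s) hd
    have l2 : dist (DiagramClass.mk (F s)) 0 / m * ((m ^ 2 : ℕ) : ℝ)
        = m * dist (DiagramClass.mk (F s)) 0 := by
      push_cast
      field_simp
    linarith
  -- Rounding changes each multiplicity by at most one.
  have e2 : dist (ofDiagram φ B) (((m ^ 2 : ℕ) : ℝ≥0) • expectVec p fun s => ofDiagram φ (F s))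
      ≤ E₂ := by
    rw [← ofDiagramClass_mk, hB, map_sum, expectVec, Finset.smul_sum]
    refine (dist_sum_sum_le_of_subadditive dist_add_add_le _ _ _).trans ?_
    refine Finset.sum_le_sum fun s _ => ?_
    rw [map_nsmul, ofDiagramClass_mk, ← Nat.cast_smul_eq_nsmul ℝ≥0, ← mul_smul]
    refine (dist_smul_left_le _ _ _).trans ?_
    have := mul_le_mul_of_nonneg_right (hk s) (dist_nonneg (x := ofDiagram φ (F s)) (y := 0))
    rw [one_mul] at this
    simpa [Real.coe_toNNReal _ (p.nonneg s)] using this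
  have e3 : ((m ^ 2 : ℕ) : ℝ) * d ≤ ikd (Diagram.mix q H) B + E₂ := by
    have := dist_smul_smul ((m ^ 2 : ℕ) : ℝ≥0) (ofDiagram φ (Diagram.mix p F))
      (expectVec p fun s => ofDiagram φ (F s))
    rw [NNReal.coe_natCast] at this
    rw [← this, Nat.cast_smul_eq_nsmul ℝ≥0 _ (ofDiagram φ (Diagram.mix p F)), ← ofDiagram_pow,
      ofDiagram_eq h1]
    exact (dist_triangle _ (ofDiagram φ B) _).trans (add_le_add (dist_ofDiagram_le _ _) e2)
  have e4 : d ≤ (Fintype.card G * (((m ^ 2 : ℕ) : ℝ) * entropy p) + (2 * m + 1) * E₁ + E₂)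
      / ((m ^ 2 : ℕ) : ℝ) := by
    rw [le_div_iff₀ (by positivity), mul_comm]
    linarith
  refine e4.trans ?_
  push_cast
  rw [div_le_iff₀ (by positivity)]
  have : (Fintype.card G * entropy p + (3 * E₁ + E₂) / m) * (m : ℝ) ^ 2
      = Fintype.card G * ((m : ℝ) ^ 2 * entropy p) + m * (3 * E₁ + E₂) := by
    field_simp
  rw [this]
  -- Uses `2 * m + 1 ≤ 3 * m` and `E₂ ≤ m * E₂`.
  nlinarith

/-- A diagram is close to the average of its conditioned diagrams. -/
lemma dist_ofDiagram_expectVec_condOn_le (X : Diagram G) (f : X.space ⊥ → S) :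
    dist (ofDiagram φ X) (expectVec ((X.law ⊥).map f) fun s => ofDiagram φ (X.condOn f s))
      ≤ 2 * Fintype.card G * entropy ((X.law ⊥).map f) := by
  -- The mixture of the conditioned diagrams is the intermediate point: it is within `|G| H(f)` of
  -- their average and of `X`.
  have h1 := dist_ofDiagram_mix_le (φ := φ) ((X.law ⊥).map f) fun s => X.condOn f s
  have h2 := (dist_ofDiagram_le (φ := φ) _ _).trans (ikd_mix_condOn_le X f)
  have h3 := dist_triangle_left (ofDiagram φ X)
    (expectVec ((X.law ⊥).map f) fun s => ofDiagram φ (X.condOn f s))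
    (ofDiagram φ (Diagram.mix ((X.law ⊥).map f) fun s => X.condOn f s))
  linarith

end TropicalDiagram

/-! ### Approximation of tropical diagrams by single diagrams. -/

/-- The terms of a quasi-linear sequence are close to the multiples of its class. -/
lemma QuasiLinear.exists_dist_smul_mk_le (Y : QuasiLinear G φ) : ∃ C : ℝ, 0 ≤ C ∧ ∀ n : ℕ, 1 ≤ n →
    dist (TropicalDiagram.ofDiagram φ (Y.seq n)) ((n : ℝ≥0) • TropicalDiagram.mk Y)
      ≤ n * (C * φ.tail n) := by
  obtain ⟨C, hC0, hC⟩ := Y.quasi'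
  refine ⟨4 * C, by positivity, fun n hn => ?_⟩
  have hn' : (1 : ℝ) ≤ n := by exact_mod_cast hn
  -- Repeated doubling of the index. The doubling that ends at `t = n * 2 ^ (k + 1)` contributes `C
  -- * φ t`, and `φ t / (4 * t) ≤ tail t - tail (2 * t)`. The errors thus telescope in the tail
  -- integrals, which is the origin of the factor `4`.
  have key : ∀ k : ℕ, aikd ((Y.seq n).pow (2 ^ k)) (Y.seq (n * 2 ^ k))
      ≤ 2 ^ k * (n * (4 * C * (φ.tail n - φ.tail (n * 2 ^ (k + 1))))) := by
    intro k
    induction k with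
    | zero =>
      have h1 : aikd ((Y.seq n).pow (2 ^ 0)) (Y.seq (n * 2 ^ 0)) = 0 := by
        rw [pow_zero, mul_one]
        refine aikd_eq_zero (ikd_zero_trans (ikd_comm _ _) (ikd_tensor_trivial _))
      rw [h1]
      have h2 := sub_nonneg.2 (φ.tail_anti hn' (by
        rw [zero_add, pow_one]
        linarith : (n : ℝ) ≤ n * 2 ^ (0 + 1)))
      positivity
    | succ k ih =>
      set t : ℝ := n * 2 ^ (k + 1) with ht
      have h2k : (1 : ℝ) ≤ 2 ^ (k + 1) := one_le_pow₀ (by norm_num)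
      have ht1 : 1 ≤ t := by nlinarith
      have h1 := φ.tail_sub ht1 (by linarith : t ≤ 2 * t)
      have e1 : φ.toFun t * ((2 * t - t) / (2 * t) ^ 2) = φ.toFun t / t / 4 := by
        field_simp
        ring
      have e2 : 2 * t = n * 2 ^ (k + 1 + 1) := by rw [ht]; ring
      rw [e1, e2] at h1
      have h2 : C * φ.toFun t
          ≤ 2 ^ (k + 1) * (n * (4 * C * (φ.tail t - φ.tail (n * 2 ^ (k + 1 + 1))))) := by
        have := mul_le_mul_of_nonneg_left h1 (by positivity : 0 ≤ 4 * C * t)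
        calc C * φ.toFun t = 4 * C * t * (φ.toFun t / t / 4) := by field_simp
          _ ≤ _ := this
          _ = _ := by rw [ht]; ring
      have hq := hC (n * 2 ^ k) (n * 2 ^ k) (by
        have := Nat.mul_pos hn (Nat.two_pow_pos k)
        omega)
      have e3 : n * 2 ^ k + n * 2 ^ k = n * 2 ^ (k + 1) := by ring
      have e4 : 2 ^ (k + 1) = 2 ^ k + 2 ^ k := by ring
      rw [e3] at hq
      have e5 : ((n * 2 ^ (k + 1) : ℕ) : ℝ) = t := by rw [ht]; push_cast; ring
      rw [e5] at hq
      have h3 := aikd_triangle ((Y.seq n).pow (2 ^ (k + 1)))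
        (((Y.seq n).pow (2 ^ k)).tensor ((Y.seq n).pow (2 ^ k))) (Y.seq (n * 2 ^ (k + 1)))
      have h4 : aikd ((Y.seq n).pow (2 ^ (k + 1)))
          (((Y.seq n).pow (2 ^ k)).tensor ((Y.seq n).pow (2 ^ k))) = 0 := by
        rw [e4]
        exact aikd_eq_zero (ikd_pow_add _ _ _)
      have h5 := aikd_triangle (((Y.seq n).pow (2 ^ k)).tensor ((Y.seq n).pow (2 ^ k)))
        ((Y.seq (n * 2 ^ k)).tensor (Y.seq (n * 2 ^ k))) (Y.seq (n * 2 ^ (k + 1)))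
      have h6 := aikd_tensor_le ((Y.seq n).pow (2 ^ k)) ((Y.seq n).pow (2 ^ k))
        (Y.seq (n * 2 ^ k)) (Y.seq (n * 2 ^ k))
      rw [aikd_symm ((Y.seq (n * 2 ^ k)).tensor (Y.seq (n * 2 ^ k)))] at h5
      have e6 : (2 : ℝ) ^ (k + 1) * (n * (4 * C * (φ.tail n - φ.tail (n * 2 ^ (k + 1 + 1)))))
          = 2 * (2 ^ k * (n * (4 * C * (φ.tail n - φ.tail t))))
            + 2 ^ (k + 1) * (n * (4 * C * (φ.tail t - φ.tail (n * 2 ^ (k + 1 + 1))))) := by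
        ring
      rw [e6]
      linarith
  -- The distance is evaluated along the subsequence of powers of two; scaling by the integer `n`
  -- involves no rounding.
  have hlim : Tendsto (fun k : ℕ => aikd ((Y.seq n).pow (2 ^ k)) (Y.seq (n * 2 ^ k))
      / ((2 ^ k : ℕ) : ℝ)) atTop
      (𝓝 (dist (TropicalDiagram.ofDiagram φ (Y.seq n)) ((n : ℝ≥0) • TropicalDiagram.mk Y))) := by
    have h := ((QuasiLinear.linear φ (Y.seq n)).tendsto_asympDist (Y.scale n)).comp
      (tendsto_pow_atTop_atTop_of_one_lt (by norm_num : 1 < 2))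
    refine h.congr fun k => ?_
    have e : ⌊((n : ℝ≥0)) * ((2 ^ k : ℕ) : ℝ≥0)⌋₊ = n * 2 ^ k := by
      rw [← Nat.cast_mul, Nat.floor_natCast]
    simp only [Function.comp, QuasiLinear.scale, QuasiLinear.linear, e]
  refine le_of_tendsto' hlim fun k => ?_
  rw [div_le_iff₀ (by positivity)]
  refine (key k).trans ?_
  have h2k : (1 : ℝ) ≤ 2 ^ (k + 1) := one_le_pow₀ (by norm_num)
  have := φ.tail_nonneg (by nlinarith : (1 : ℝ) ≤ n * 2 ^ (k + 1))
  push_cast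
  rw [mul_comm]
  gcongr
  linarith

namespace TropicalDiagram

/-- Dividing the preceding estimate by `n` leaves a multiple of the tail integral at `n`, which
tends to zero. -/
lemma tendsto_inv_smul_ofDiagram (Y : QuasiLinear G φ) :
    Tendsto (fun n : ℕ => (n : ℝ≥0)⁻¹ • ofDiagram φ (Y.seq n)) atTop (𝓝 (mk Y)) := by
  obtain ⟨C, hC0, hC⟩ := Y.exists_dist_smul_mk_le
  have h := φ.tail_tendsto.const_mul C
  rw [mul_zero] at h
  refine tendsto_iff_dist_tendsto_zero.2 (squeeze_zero' (Eventually.of_forall fun _ => dist_nonneg)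
    ?_ h)
  filter_upwards [eventually_ge_atTop 1] with n hn
  have hn' : (n : ℝ≥0) ≠ 0 := by exact_mod_cast (by omega : n ≠ 0)
  have hn'' : (0 : ℝ) < n := by exact_mod_cast hn
  have h1 := dist_smul_smul (n : ℝ≥0)⁻¹ (ofDiagram φ (Y.seq n)) ((n : ℝ≥0) • mk Y)
  rw [inv_smul_smul₀ hn'] at h1
  rw [h1, NNReal.coe_inv, NNReal.coe_natCast, inv_mul_le_iff₀ hn'']
  exact hC n hn

/-- Every tropical diagram is at bounded distance from the class of a linear sequence. -/
lemma exists_dist_ofDiagram_le (t : TropicalDiagram G φ) :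
    ∃ W : Diagram G, dist (ofDiagram φ W) t ≤ Fintype.card G + 1 := by
  obtain ⟨Y, rfl⟩ := mk_surjective t
  -- Some `m⁻¹ • [Y(m)]` is within `1` of the given class. It remains to realise the scalar `m⁻¹` by
  -- a diagram.
  obtain ⟨m, hm, hm1⟩ := (((tendsto_inv_smul_ofDiagram Y).eventually
    (Metric.closedBall_mem_nhds _ one_pos)).and (eventually_ge_atTop 1)).exists
  have hm' : (1 : ℝ) ≤ m := by exact_mod_cast hm1
  have h0 : (0 : ℝ) ≤ (m : ℝ)⁻¹ := by positivity
  have h1 : (0 : ℝ) ≤ 1 - (m : ℝ)⁻¹ := sub_nonneg.2 (inv_le_one_of_one_le₀ hm')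
  -- A coin selects `Y(m)` with probability `m⁻¹` and otherwise the trivial diagram, whose class is
  -- `0`. The mixture is within `|G| H(p)` of the convex combination, and a coin has entropy at most
  -- `1`, whatever `m` is.
  set p : Distribution Bool := Convexity.StdSimplex.duple true false h0 h1 (by ring) with hp
  set F : Bool → Diagram G := fun b => bif b then Y.seq m else Diagram.trivial G
  have hE : expectVec p (fun b => ofDiagram φ (F b)) = (m : ℝ≥0)⁻¹ • ofDiagram φ (Y.seq m) := by
    rw [expectVec, Finset.sum_subset (Finset.subset_univ _) fun b _ hb => by
      rw [Finsupp.notMem_support_iff.1 hb, Real.toNNReal_zero, zero_smul]]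
    have e : (m : ℝ)⁻¹.toNNReal = (m : ℝ≥0)⁻¹ := by
      rw [Real.toNNReal_inv, Real.toNNReal_natCast]
    simp [p, F, ofDiagram_trivial, e]
  have hcard : entropy p ≤ 1 := by
    refine (entropy_le_card_sub_one p).trans ?_
    have : p.weights.support.card ≤ 2 := Finset.card_le_univ _
    have : (p.weights.support.card : ℝ) ≤ 2 := by exact_mod_cast this
    linarith
  refine ⟨Diagram.mix p F, (dist_triangle _ _ _).trans (add_le_add ?_ hm)⟩
  rw [← hE]
  refine (dist_ofDiagram_mix_le p F).trans ?_
  have := mul_le_mul_of_nonneg_left hcard (Fintype.card G).cast_nonneg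
  linarith

end TropicalDiagram

end TropProb

/-! ### The Lipschitz estimate for conditioning of diagrams. -/

namespace TropProb

variable {G : Type*} [PartialOrder G] [Fintype G] [OrderBot G] {S T : Type} {φ : AdmissibleFunction}

/-- Expresses the sum over atoms as an average over the law of a function on the initial space, the
form in which conditionings of the feet and of the top of a fan can be compared. -/
lemma Diagram.tropicalCond_eq (X : Diagram G) (ι : G) :
    X.tropicalCond φ ι = expectVec ((X.law ⊥).map (X.map (bot_le : ⊥ ≤ ι))) fun u =>
      TropicalDiagram.ofDiagram φ (X.condOn (X.map (bot_le : ⊥ ≤ ι)) u) := by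
  unfold Diagram.tropicalCond expectVec
  simp only [Diagram.cond_eq_condOn]
  rw [X.map_law]
  exact Finset.sum_coe_sort (X.law ι).weights.support fun u =>
    ((X.law ι).weights u).toNNReal •
      TropicalDiagram.ofDiagram φ (X.condOn (X.map (bot_le : ⊥ ≤ ι)) u)

/-- Conditioning on a function of `X` does not increase the entropy defect of a reduction
`Z → X`. -/
lemma Reduction.expect_ent_condOn_sub_le {Z X : Diagram G} (r : Reduction Z X)
    (f : X.space ⊥ → S) (i : G) :
    expect ((X.law ⊥).map f) (fun s =>
      (Z.condOn (fun z => f (r.app ⊥ z)) s).ent i - (X.condOn f s).ent i)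
      ≤ Z.ent i - X.ent i := by
  have hp : (Z.law ⊥).map (fun z => f (r.app ⊥ z)) = (X.law ⊥).map f := by
    rw [← r.map_law ⊥, Convexity.StdSimplex.map_map]
  have hZ := entropy_map_prodMk (Z.law ⊥) (fun z => f (r.app ⊥ z)) (Z.map (bot_le : ⊥ ≤ i))
  have hX := entropy_map_prodMk (X.law ⊥) f (X.map (bot_le : ⊥ ≤ i))
  rw [hp] at hZ
  -- The joint law of `((U, X_i), Z_i)` with `U = f`. Submodularity over `X_i` gives `H(U, X_i, Z_i)
  -- + H(X_i) ≤ H(U, X_i) + H(Z_i)`. Dropping `X_i` from the first term and applying the chain rule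
  -- to `(U, Z_i)` and `(U, X_i)` yields the claim.
  set c := (Z.law ⊥).map fun z =>
    ((f (r.app ⊥ z), r.app i (Z.map (bot_le : ⊥ ≤ i) z)), Z.map (bot_le : ⊥ ≤ i) z) with hc
  have h1 := entropy_submod c Prod.snd (r.app i) (by
    intro x hx
    obtain ⟨z, -, rfl⟩ := exists_of_mem_support_map hx
    rfl)
  have h2 := entropy_map_le c fun x => (x.1.1, x.2)
  have e1 : c.map (fun x => (x.1.1, x.2))
      = (Z.law ⊥).map fun z => (f (r.app ⊥ z), Z.map (bot_le : ⊥ ≤ i) z) :=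
    Convexity.StdSimplex.map_map _ _ _
  have e2 : c.map Prod.fst = (X.law ⊥).map fun x => (f x, X.map (bot_le : ⊥ ≤ i) x) := by
    rw [← r.map_law ⊥, hc, Convexity.StdSimplex.map_map, Convexity.StdSimplex.map_map]
    exact map_congr _ fun z hz => by rw [r.naturality _ z hz]
  have e3 : c.map Prod.snd = Z.law i := by
    rw [hc, Convexity.StdSimplex.map_map]
    exact Z.map_law _
  have e4 : (c.map Prod.fst).map Prod.snd = X.law i := by
    rw [e2, Convexity.StdSimplex.map_map]
    exact X.map_law _
  rw [e4, e2, e3] at h1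
  rw [e1] at h2
  rw [expect_sub]
  change expect _ (fun s => entropy ((condDist (Z.law ⊥) (fun z => f (r.app ⊥ z)) s).map
    (Z.map (bot_le : ⊥ ≤ i)))) - expect _ (fun s => entropy ((condDist (X.law ⊥) f s).map
    (X.map (bot_le : ⊥ ≤ i)))) ≤ entropy (Z.law i) - entropy (X.law i)
  linarith

lemma condDist_tensor {S' T' : Type} (p : Distribution S) (q : Distribution T) (f : S → S')
    (g : T → T') {a : S'} {b : T'} (ha : a ∈ (p.map f).weights.support)
    (hb : b ∈ (q.map g).weights.support) :
    condDist (tensorDist p q) (Prod.map f g) (a, b)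
      = tensorDist (condDist p f a) (condDist q g b) := by
  classical
  have hab : (a, b) ∈ ((tensorDist p q).map (Prod.map f g)).weights.support := by
    rw [map_tensor]
    exact mem_support_tensor.2 ⟨ha, hb⟩
  have hw : ((tensorDist p q).map (Prod.map f g)).weights (a, b)
      = (p.map f).weights a * (q.map g).weights b := by
    rw [map_tensor]
    rfl
  refine dist_ext fun F => ?_
  rw [expect_condDist hab, hw, expect_tensor, expect_tensor, expect_condDist ha, mul_inv, mul_assoc,
    ← expect_const_mul p]
  congr 1
  refine expect_congr p fun x _ => ?_
  rw [expect_condDist hb]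
  by_cases hx : f x = a <;> simp [hx, expect_const]

/-- The two diagrams have the same sets and maps, and conditioning a product law on a product event
factorises, so the identity maps form a reduction. -/
lemma Diagram.ikd_condOn_tensor (X Y : Diagram G) (f : X.space ⊥ → S) (g : Y.space ⊥ → T)
    {x : S × T} (hx : x.1 ∈ ((X.law ⊥).map f).weights.support)
    (hy : x.2 ∈ ((Y.law ⊥).map g).weights.support) :
    ikd ((X.tensor Y).condOn (Prod.map f g) x) ((X.condOn f x.1).tensor (Y.condOn g x.2)) = 0 := by
  have h : ∀ i, ((X.tensor Y).condOn (Prod.map f g) x).law i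
      = ((X.condOn f x.1).tensor (Y.condOn g x.2)).law i := fun i =>
    (congrArg (fun μ => Convexity.StdSimplex.map (Prod.map (X.map (bot_le : ⊥ ≤ i))
      (Y.map (bot_le : ⊥ ≤ i))) μ) (condDist_tensor (X.law ⊥) (Y.law ⊥) f g hx hy)).trans
      (map_tensor _ _ _ _)
  exact ikd_eq_zero ⟨fun _ => id, fun i => (Convexity.StdSimplex.map_id _).trans (h i),
    fun _ _ _ => rfl⟩ fun i => congrArg entropy (h i)

namespace TropicalDiagram

/-- For each `s` the conditioned reduction, with the identity as second leg, is a fan whose distance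
is the entropy defect of the conditioned diagrams. On average this is at most the defect of `r`. -/
lemma dist_expectVec_condOn_reduction_le {Z X : Diagram G} (r : Reduction Z X)
    (f : X.space ⊥ → S) :
    dist (expectVec ((X.law ⊥).map f) fun s => ofDiagram φ (X.condOn f s))
      (expectVec ((Z.law ⊥).map fun z => f (r.app ⊥ z)) fun s =>
        ofDiagram φ (Z.condOn (fun z => f (r.app ⊥ z)) s))
      ≤ ∑ i, (Z.ent i - X.ent i) := by
  have hp : (Z.law ⊥).map (fun z => f (r.app ⊥ z)) = (X.law ⊥).map f := by
    rw [← r.map_law ⊥, Convexity.StdSimplex.map_map]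
  rw [hp]
  refine (dist_expectVec_le _ _ _).trans ?_
  have h : ∀ s ∈ ((X.law ⊥).map f).weights.support,
      dist (ofDiagram φ (X.condOn f s)) (ofDiagram φ (Z.condOn (fun z => f (r.app ⊥ z)) s))
        ≤ ∑ i, ((Z.condOn (fun z => f (r.app ⊥ z)) s).ent i - (X.condOn f s).ent i) := by
    intro s hs
    refine (dist_ofDiagram_le _ _).trans ((ikd_le ⟨_, r.condOn f hs, Reduction.refl _⟩).trans ?_)
    rw [Fan.kd_eq]
    exact Finset.sum_le_sum fun i _ => by simp only; linarith
  refine (expect_mono _ h).trans ?_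
  rw [expect_sum]
  exact Finset.sum_le_sum fun i _ => r.expect_ent_condOn_sub_le f i

/-- Inside each `Z` given `f = s`, conditioning further on `g` costs `2|G|` times the entropy of `g`
there. By the chain rule these costs average to `2|G| H(g | f)`. -/
lemma dist_expectVec_condOn_condOn_le (Z : Diagram G) (f : Z.space ⊥ → S) (g : Z.space ⊥ → T) :
    dist (expectVec ((Z.law ⊥).map f) fun s => ofDiagram φ (Z.condOn f s))
      (expectVec (Z.law ⊥) fun z => ofDiagram φ ((Z.condOn f (f z)).condOn g (g z)))
      ≤ 2 * Fintype.card G *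
        (entropy ((Z.law ⊥).map fun z => (f z, g z)) - entropy ((Z.law ⊥).map f)) := by
  rw [← expectVec_condDist_map (Z.law ⊥) f g fun s t => ofDiagram φ ((Z.condOn f s).condOn g t),
    entropy_map_prodMk, add_sub_cancel_left, ← expect_const_mul]
  refine (dist_expectVec_le _ _ _).trans (expect_mono _ fun s _ => ?_)
  have h := dist_ofDiagram_expectVec_condOn_le (φ := φ) (Z.condOn f s) g
  rwa [Z.condOn_law_bot] at h

/-- The effect of conditioning on the distance is controlled by the entropy distance of fans. -/
lemma dist_tropicalCond_le_kd {X Y : Diagram G} (K : Fan X Y) (ι : G) :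
    dist (X.tropicalCond φ ι) (Y.tropicalCond φ ι) ≤ (2 * Fintype.card G + 1) * K.kd := by
  set Z := K.top
  set f : Z.space ⊥ → X.space ι := fun z => X.map bot_le (K.left.app ⊥ z) with hf
  set g : Z.space ⊥ → Y.space ι := fun z => Y.map bot_le (K.right.app ⊥ z) with hg
  have hl := dist_expectVec_condOn_reduction_le (φ := φ) K.left (X.map (bot_le : ⊥ ≤ ι))
  have hr := dist_expectVec_condOn_reduction_le (φ := φ) K.right (Y.map (bot_le : ⊥ ≤ ι))
  rw [← X.tropicalCond_eq] at hl
  rw [← Y.tropicalCond_eq] at hr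
  have hfg := dist_expectVec_condOn_condOn_le (φ := φ) Z f g
  have hgf := dist_expectVec_condOn_condOn_le (φ := φ) Z g f
  -- The doubly conditioned average does not depend on the order, so it is a common meeting point
  -- for the two sides.
  have hcomm : expectVec (Z.law ⊥) (fun z => ofDiagram φ ((Z.condOn f (f z)).condOn g (g z)))
      = expectVec (Z.law ⊥) (fun z => ofDiagram φ ((Z.condOn g (g z)).condOn f (f z))) :=
    expectVec_congr _ fun z hz => by rw [Z.condOn_comm f g hz]
  rw [← hcomm] at hgf
  have hft : (Z.law ⊥).map f = X.law ι := by
    rw [← X.map_law (bot_le : ⊥ ≤ ι), ← K.left.map_law ⊥, Convexity.StdSimplex.map_map]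
  have hgt : (Z.law ⊥).map g = Y.law ι := by
    rw [← Y.map_law (bot_le : ⊥ ≤ ι), ← K.right.map_law ⊥, Convexity.StdSimplex.map_map]
  -- By naturality `f` and `g` factor through `Z_ι` on the support, hence the pair has entropy at
  -- most that of `Z_ι`.
  have hZι : ∀ {C : Type} (k : Z.space ι → C) (k' : Z.space ⊥ → C),
      (∀ z ∈ (Z.law ⊥).weights.support, k' z = k (Z.map bot_le z)) →
      entropy ((Z.law ⊥).map k') ≤ Z.ent ι := by
    intro C k k' hk
    have := entropy_map_le (Z.law ι) k
    rw [← Z.map_law (bot_le : ⊥ ≤ ι), Convexity.StdSimplex.map_map, Z.map_law,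
      ← map_congr _ hk] at this
    exact this
  have h1 := hZι (fun z => (K.left.app ι z, K.right.app ι z)) (fun z => (f z, g z))
    fun z hz => by rw [K.left.naturality _ z hz, K.right.naturality _ z hz]
  have h2 := hZι (fun z => (K.right.app ι z, K.left.app ι z)) (fun z => (g z, f z))
    fun z hz => by rw [K.left.naturality _ z hz, K.right.naturality _ z hz]
  rw [hft] at hfg
  rw [hgt] at hgf
  have hc : (0 : ℝ) ≤ 2 * Fintype.card G := by positivity
  have h3 := hfg.trans (mul_le_mul_of_nonneg_left (sub_le_sub_right h1 _) hc)
  have h4 := hgf.trans (mul_le_mul_of_nonneg_left (sub_le_sub_right h2 _) hc)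
  -- The defects at `ι` form one of the nonnegative summands of the fan's distance.
  have hι : (Z.ent ι - X.ent ι) + (Z.ent ι - Y.ent ι) ≤ K.kd := by
    rw [Fan.kd_eq]
    refine le_trans (le_of_eq ?_) (Finset.single_le_sum (fun i _ => ?_) (Finset.mem_univ ι))
    · ring
    · have := K.left.ent_le i
      have := K.right.ent_le i
      linarith
  have hkd : ∑ i, (Z.ent i - X.ent i) + ∑ i, (Z.ent i - Y.ent i) = K.kd := by
    rw [Fan.kd_eq, ← Finset.sum_add_distrib]
    exact Finset.sum_congr rfl fun i _ => by ring
  have h5 := mul_le_mul_of_nonneg_left hι hc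
  rw [← hf] at hl
  rw [← hg] at hr
  rw [hft] at hl
  rw [hgt] at hr
  have t1 := dist_triangle (X.tropicalCond φ ι)
    (expectVec (X.law ι) fun s => ofDiagram φ (Z.condOn f s)) (Y.tropicalCond φ ι)
  have t2 := dist_triangle (expectVec (X.law ι) fun s => ofDiagram φ (Z.condOn f s))
    (expectVec (Y.law ι) fun s => ofDiagram φ (Z.condOn g s)) (Y.tropicalCond φ ι)
  have t3 := dist_triangle_right (expectVec (X.law ι) fun s => ofDiagram φ (Z.condOn f s))
    (expectVec (Y.law ι) fun s => ofDiagram φ (Z.condOn g s))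
    (expectVec (Z.law ⊥) fun z => ofDiagram φ ((Z.condOn f (f z)).condOn g (g z)))
  rw [dist_comm] at hr
  unfold Diagram.ent at *
  -- The two changes of diagram add up to `kd`, and the two refinements of the conditioning to at
  -- most `2|G| * kd`.
  linarith

lemma dist_tropicalCond_le_ikd (X Y : Diagram G) (ι : G) :
    dist (X.tropicalCond φ ι) (Y.tropicalCond φ ι) ≤ (2 * Fintype.card G + 1) * ikd X Y := by
  have hc : (0 : ℝ) ≤ 2 * Fintype.card G + 1 := by positivity
  unfold ikd
  rw [Real.mul_iInf_of_nonneg hc]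
  exact le_ciInf fun K => dist_tropicalCond_le_kd K ι

/-- Conditioning takes tensor products to sums. -/
lemma tropicalCond_tensor (X Y : Diagram G) (ι : G) :
    (X.tensor Y).tropicalCond φ ι = X.tropicalCond φ ι + Y.tropicalCond φ ι := by
  have h : ∀ Z : Diagram G, Z.tropicalCond φ ι = expectVec (Z.law ι) fun u =>
      ofDiagram φ (Z.condOn (Z.map (bot_le : ⊥ ≤ ι)) u) := fun Z => by
    rw [Z.tropicalCond_eq, Z.map_law]
  have hX := expectVec_map (tensorDist (X.law ι) (Y.law ι)) Prod.fst fun u =>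
    ofDiagram φ (X.condOn (X.map (bot_le : ⊥ ≤ ι)) u)
  have hY := expectVec_map (tensorDist (X.law ι) (Y.law ι)) Prod.snd fun u =>
    ofDiagram φ (Y.condOn (Y.map (bot_le : ⊥ ≤ ι)) u)
  rw [tensor_map_fst] at hX
  rw [tensor_map_snd] at hY
  rw [h, h, h, hX, hY, ← expectVec_add]
  refine expectVec_congr (tensorDist (X.law ι) (Y.law ι)) fun x hx => ?_
  obtain ⟨h1, h2⟩ := mem_support_tensor.1 hx
  rw [← ofDiagram_tensor]
  refine ofDiagram_eq (Diagram.ikd_condOn_tensor X Y _ _ ?_ ?_)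
  · rwa [X.map_law]
  · rwa [Y.map_law]

lemma distribution_unit_eq (p q : Distribution Unit) : p = q :=
  dist_ext fun F => (expect_const p (F ())).trans (expect_const q (F ())).symm

lemma tropicalCond_trivial (ι : G) : (Diagram.trivial G).tropicalCond φ ι = 0 := by
  rw [Diagram.tropicalCond_eq]
  refine (expectVec_congr _ fun u _ => ?_).trans (expectVec_const _ 0)
  refine ofDiagram_eq (ikd_eq_zero (Y := Diagram.trivial G)
    ⟨fun _ => id, fun i => ?_, fun _ _ _ => rfl⟩ fun i => ?_)
  · exact distribution_unit_eq _ _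
  · exact congrArg entropy (distribution_unit_eq _ _)

lemma tropicalCond_pow (X : Diagram G) (ι : G) (n : ℕ) :
    (X.pow n).tropicalCond φ ι = n • X.tropicalCond φ ι := by
  induction n with
  | zero => rw [zero_smul]; exact tropicalCond_trivial ι
  | succ n ih => rw [succ_nsmul, ← ih]; exact tropicalCond_tensor _ _ ι

/-- Conditioning of diagrams is Lipschitz for the asymptotic entropy distance. -/
lemma dist_tropicalCond_le (X Y : Diagram G) (ι : G) :
    dist (X.tropicalCond φ ι) (Y.tropicalCond φ ι) ≤ (2 * Fintype.card G + 1) * aikd X Y := by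
  refine ge_of_tendsto ((tendsto_aikd X Y).const_mul (2 * (Fintype.card G : ℝ) + 1)) ?_
  filter_upwards [eventually_gt_atTop 0] with n hn
  -- Conditioning multiplies by `n` on `n`-th powers, so dividing this estimate by `n` and letting
  -- `n` grow replaces the intrinsic distance by the asymptotic one.
  have h := dist_tropicalCond_le_ikd (φ := φ) (X.pow n) (Y.pow n) ι
  rw [tropicalCond_pow, tropicalCond_pow, ← Nat.cast_smul_eq_nsmul ℝ≥0,
    ← Nat.cast_smul_eq_nsmul ℝ≥0, dist_smul_smul, NNReal.coe_natCast] at h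
  rw [← mul_div_assoc, le_div_iff₀ (by exact_mod_cast hn), mul_comm]
  exact h

end TropicalDiagram

end TropProb

/-! ### Passage to the limit and the tropical conditioning map. -/

namespace TropProb

variable {G : Type*} [PartialOrder G] [Fintype G] [OrderBot G] {φ : AdmissibleFunction}

namespace TropicalDiagram

/-- A quasi-linear sequence of tropical diagrams has an average. -/
lemma exists_tendsto_inv_smul (x : ℕ → TropicalDiagram G φ) (C : ℝ)
    (h : ∀ n m : ℕ, 1 ≤ n + m → dist (x (n + m)) (x n + x m) ≤ C * φ.toFun ((n + m : ℕ) : ℝ)) :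
    ∃ y, Tendsto (fun n : ℕ => (n : ℝ≥0)⁻¹ • x n) atTop (𝓝 y) := by
  -- Replacing each term by the class of a single diagram at uniformly bounded distance provides a
  -- candidate for the limit, namely the class of the sequence `W`.
  choose W hW using fun n => exists_dist_ofDiagram_le (x n)
  set D : ℝ := Fintype.card G + 1
  have hD : 0 ≤ D := by positivity
  -- Three terms are replaced, at indices `n + m`, `n` and `m`, each at cost at most `D`. Since `φ`
  -- is bounded below by `φ 1 > 0`, the constant `3 * D` is absorbed into the admissible error.
  let Y : QuasiLinear G φ := ⟨W, 3 * D / φ.toFun 1 + C, fun n m hnm => by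
    have hnm' : (1 : ℝ) ≤ ((n + m : ℕ) : ℝ) := by exact_mod_cast hnm
    have h1 : 3 * D ≤ 3 * D / φ.toFun 1 * φ.toFun ((n + m : ℕ) : ℝ) := by
      rw [div_mul_eq_mul_div, le_div_iff₀ (φ.pos 1 le_rfl)]
      exact mul_le_mul_of_nonneg_left (φ.mono (Set.mem_Ici.2 le_rfl) hnm' hnm') (by positivity)
    rw [← dist_ofDiagram (φ := φ), ofDiagram_tensor]
    have h2 := dist_triangle4 (ofDiagram φ (W (n + m))) (x (n + m)) (x n + x m)
      (ofDiagram φ (W n) + ofDiagram φ (W m))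
    have h3 := dist_add_add_le (x n) (x m) (ofDiagram φ (W n)) (ofDiagram φ (W m))
    rw [dist_comm (x n), dist_comm (x m)] at h3
    linarith [hW n, hW m, hW (n + m), h n m hnm]⟩
  refine ⟨mk Y, (tendsto_inv_smul_ofDiagram Y).congr_dist (squeeze_zero (fun _ => dist_nonneg)
    (fun n => ?_) (tendsto_const_div_atTop_nhds_zero_nat D))⟩
  rw [dist_smul_smul, NNReal.coe_inv, NNReal.coe_natCast, div_eq_inv_mul]
  exact mul_le_mul_of_nonneg_left (hW n) (by positivity)

end TropicalDiagram

namespace QuasiLinear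

/-- Additivity and the Lipschitz bound transport the quasi-linearity of `X` to the conditioned
sequence, with its constant multiplied by `2|G| + 1`. -/
lemma exists_tendsto_tropicalCond (X : QuasiLinear G φ) (ι : G) :
    ∃ y, Tendsto (fun n : ℕ => (n : ℝ≥0)⁻¹ • (X.seq n).tropicalCond φ ι) atTop (𝓝 y) := by
  obtain ⟨C, hC⟩ := X.quasi
  refine TropicalDiagram.exists_tendsto_inv_smul _ ((2 * Fintype.card G + 1) * C) fun n m hnm => ?_
  rw [← TropicalDiagram.tropicalCond_tensor, mul_assoc]
  exact (TropicalDiagram.dist_tropicalCond_le _ _ ι).trans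
    (mul_le_mul_of_nonneg_left (hC n m hnm) (by positivity))

/-- The tropical conditioning of a quasi-linear sequence. -/
noncomputable def tropicalCond (ι : G) (X : QuasiLinear G φ) : TropicalDiagram G φ :=
  (X.exists_tendsto_tropicalCond ι).choose

lemma tendsto_tropicalCond (X : QuasiLinear G φ) (ι : G) :
    Tendsto (fun n : ℕ => (n : ℝ≥0)⁻¹ • (X.seq n).tropicalCond φ ι) atTop
      (𝓝 (X.tropicalCond ι)) :=
  (X.exists_tendsto_tropicalCond ι).choose_spec

lemma dist_tropicalCond_le (X Y : QuasiLinear G φ) (ι : G) :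
    dist (X.tropicalCond ι) (Y.tropicalCond ι) ≤ (2 * Fintype.card G + 1) * dist X Y := by
  refine le_of_tendsto_of_tendsto' ((X.tendsto_tropicalCond ι).dist (Y.tendsto_tropicalCond ι))
    ((X.tendsto_asympDist Y).const_mul (2 * (Fintype.card G : ℝ) + 1)) fun n => ?_
  rw [TropicalDiagram.dist_smul_smul, NNReal.coe_inv, NNReal.coe_natCast, mul_div_assoc',
    div_eq_inv_mul]
  exact mul_le_mul_of_nonneg_left (TropicalDiagram.dist_tropicalCond_le _ _ ι) (by positivity)

/-- Independence of the representative: the Lipschitz bound forces distance zero, and tropical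
diagrams form a genuine metric space. -/
lemma tropicalCond_eq_of_dist_eq_zero {X Y : QuasiLinear G φ} (h : dist X Y = 0) (ι : G) :
    X.tropicalCond ι = Y.tropicalCond ι :=
  dist_eq_zero.1 (le_antisymm ((X.dist_tropicalCond_le Y ι).trans (by rw [h, mul_zero]))
    dist_nonneg)

lemma tropicalCond_tensor (X Y : QuasiLinear G φ) (ι : G) :
    (X.tensor Y).tropicalCond ι = X.tropicalCond ι + Y.tropicalCond ι := by
  refine tendsto_nhds_unique ((X.tensor Y).tendsto_tropicalCond ι)
    (((X.tendsto_tropicalCond ι).add (Y.tendsto_tropicalCond ι)).congr fun n => ?_)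
  rw [← smul_add, ← TropicalDiagram.tropicalCond_tensor]
  rfl

lemma tropicalCond_scale (r : ℝ≥0) (X : QuasiLinear G φ) (ι : G) :
    (X.scale r).tropicalCond ι = r • X.tropicalCond ι := by
  refine tendsto_nhds_unique ((X.scale r).tendsto_tropicalCond ι) ?_
  -- For `r = 0` the index `⌊r n⌋` stays at `0` and is not a subsequence. The conditioned term is
  -- then constant, and its multiples by `n⁻¹` tend to zero.
  rcases eq_or_lt_of_le (zero_le (a := r)) with rfl | hr
  · have h := (tendsto_inv_atTop_zero.comp (tendsto_natCast_atTop_atTop (R := ℝ≥0))).smul_const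
      ((X.seq 0).tropicalCond φ ι)
    rw [zero_smul] at h ⊢
    simpa [scale, Function.comp_def] using h
  · have hfl : Tendsto (fun n : ℕ => ((⌊r * n⌋₊ : ℕ) : ℝ≥0) / n) atTop (𝓝 r) := by
      refine NNReal.tendsto_coe.1 (((tendsto_nat_floor_mul_div_atTop r.2).comp
        tendsto_natCast_atTop_atTop).congr fun n => ?_)
      have e : ⌊r * (n : ℝ≥0)⌋₊ = ⌊(r : ℝ) * n⌋₊ := by
        refine (Nat.floor_eq_iff zero_le).2 ⟨?_, ?_⟩
        · rw [← NNReal.coe_le_coe]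
          push_cast
          exact Nat.floor_le (by positivity)
        · rw [← NNReal.coe_lt_coe]
          push_cast
          exact Nat.lt_floor_add_one _
      simp only [Function.comp, e, NNReal.coe_div, NNReal.coe_natCast]
      rfl
    have hinf : Tendsto (fun n : ℕ => ⌊r * (n : ℝ≥0)⌋₊) atTop atTop :=
      tendsto_nat_floor_atTop.comp (tendsto_natCast_atTop_atTop.const_mul_atTop hr)
    -- Here `n⁻¹ = (⌊r n⌋ / n) * ⌊r n⌋⁻¹`, where the first factor tends to `r` and the second
    -- normalises the term at index `⌊r n⌋`.
    refine (hfl.smul ((X.tendsto_tropicalCond ι).comp hinf)).congr' ?_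
    filter_upwards [hinf.eventually_gt_atTop 0] with n hn
    have hn' : ((⌊r * (n : ℝ≥0)⌋₊ : ℕ) : ℝ≥0) ≠ 0 := by exact_mod_cast hn.ne'
    simp only [scale, Function.comp, smul_smul]
    congr 1
    field_simp

end QuasiLinear

namespace TropicalDiagram

/-- The tropical conditioning map. -/
noncomputable def cond (ι : G) : TropicalDiagram G φ →ₗ[ℝ≥0] TropicalDiagram G φ where
  toFun := Quotient.lift (QuasiLinear.tropicalCond ι) fun _ _ h =>
    QuasiLinear.tropicalCond_eq_of_dist_eq_zero (inseparable_iff.1 h) ι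
  map_add' a b := by
    obtain ⟨X, rfl⟩ := mk_surjective a
    obtain ⟨Y, rfl⟩ := mk_surjective b
    exact QuasiLinear.tropicalCond_tensor X Y ι
  map_smul' r a := by
    obtain ⟨X, rfl⟩ := mk_surjective a
    exact QuasiLinear.tropicalCond_scale r X ι

lemma lipschitzWith_cond (ι : G) :
    LipschitzWith (2 * (Fintype.card G : ℝ≥0) + 1)
      (cond ι : TropicalDiagram G φ →ₗ[ℝ≥0] TropicalDiagram G φ) := by
  refine LipschitzWith.of_dist_le_mul fun a b => ?_
  obtain ⟨X, rfl⟩ := mk_surjective a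
  obtain ⟨Y, rfl⟩ := mk_surjective b
  refine (X.dist_tropicalCond_le Y ι).trans_eq ?_
  push_cast
  rfl

end TropicalDiagram

end TropProb

/-- The limit is the value at `mk X` of a map on classes, so existence of the limit and independence
of the representative are asserted together. -/
theorem mainTheorem4 {G : Type*} [SemilatticeInf G] [OrderBot G] [Fintype G]
    (φ : TropProb.AdmissibleFunction) (ι : G) :
    ∃ cond : TropProb.TropicalDiagram G φ →ₗ[ℝ≥0] TropProb.TropicalDiagram G φ,
      (∀ X : TropProb.QuasiLinear G φ,
        Tendsto (fun n : ℕ => (n : ℝ≥0)⁻¹ • (X.seq n).tropicalCond φ ι) atTop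
          (𝓝 (cond (TropProb.TropicalDiagram.mk X)))) ∧
      LipschitzWith (2 * (Fintype.card G : ℝ≥0) + 1) cond :=
  ⟨TropProb.TropicalDiagram.cond ι, fun X => X.tendsto_tropicalCond ι,
    TropProb.TropicalDiagram.lipschitzWith_cond ι⟩
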